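/- Let $ABC$ be an equilateral triangle that is $N$-tiled, i.e. cut into $N$ triangles with pairwise disjoint interiors, each congruent (reflections allowed) to one triangle, the tile, with angles $(\alpha,\beta,\frac{\pi}{3})$ and opposite sides $(a,b,c)$ respectively. Suppose that $\beta$ is not a rational multiple of $\pi$. Then the tiles can be colored black and white so that the tile at $A$ is black and any two different tiles that share a segment of positive length have different colors, and the number $M$ of black tiles minus the number of white tiles in such a coloring (the coloring number of the tiling) is the same for every such coloring. Moreover: (i) $\zeta=e^{i\alpha}$ satisfies the quadratic equation $$\left(M^2(-i\sqrt3-1)+N(3i\sqrt3+3)\right)\zeta^2+\left(M^2(-i\sqrt3+1)+N(-3i\sqrt3+3)\right)\zeta+2M^2-6N=0,$$ whose coefficients lie in $\mathbb{Q}(i\sqrt3)$ and whose leading coefficient is nonzero. (ii) $N$ and $M$ determine the shape of the tile: $a/c$ and $b/c$ are, in some order, the two numbers $$\frac12\left(\frac{3N+M^2}{3N-M^2}\pm\frac{\sqrt{(9N-M^2)(N-M^2)}}{3N-M^2}\right),$$ one with the sign $+$ and the other with the sign $-$. (iii) $M^2<N$. -/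

import Mathlib

open EuclideanGeometry
open scoped Real IntermediateField

/-- The Euclidean plane. -/
abbrev Plane : Type := EuclideanSpace ℝ (Fin 2)

/-- An `N`-tiling of the triangle `Δ` by the tile `T`: the (closed) triangle `Δ` is cut into `N`
triangles with pairwise disjoint interiors, each congruent to `T`.  The vertices of the pieces are
listed so that they correspond under the congruence to the vertices of `T`; reflected copies of `T`
are allowed. -/
structure Tiling (Δ T : Affine.Triangle ℝ Plane) (N : ℕ) where
  /-- The pieces of the tiling. -/
  piece : Fin N → Affine.Triangle ℝ Plane
  congruent : ∀ i, Congruent (piece i).points T.points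
  cover : ⋃ i, (piece i).closedInterior = Δ.closedInterior
  disjoint : ∀ i j, i ≠ j → Disjoint (piece i).interior (piece j).interior

namespace Tiling

variable {Δ T : Affine.Triangle ℝ Plane} {N : ℕ}

/-- Two different pieces are adjacent if they share a segment of positive length (so that one can
cross from one to the other without passing through a vertex). -/
def Adjacent (τ : Tiling Δ T N) (i j : Fin N) : Prop :=
  i ≠ j ∧ ∃ P Q : Plane, P ≠ Q ∧
    segment ℝ P Q ⊆ (τ.piece i).closedInterior ∩ (τ.piece j).closedInterior

/-- A black (`true`) and white (`false`) coloring of the pieces in which the tile at the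
vertex `A = Δ.points 0` is black and the color changes across every tile boundary. -/
def IsColoring (τ : Tiling Δ T N) (κ : Fin N → Bool) : Prop :=
  (∀ i, Δ.points 0 ∈ (τ.piece i).closedInterior → κ i = true) ∧
  ∀ i j, τ.Adjacent i j → κ i ≠ κ j

/-- `M` is a coloring number of the tiling: the number of black tiles minus the number of white
tiles in a coloring. -/
def IsColoringNumber (τ : Tiling Δ T N) (M : ℤ) : Prop :=
  ∃ κ : Fin N → Bool, τ.IsColoring κ ∧
    M = ((Finset.univ.filter fun i => κ i = true).card : ℤ) -
      ((Finset.univ.filter fun i => κ i = false).card : ℤ)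

end Tiling

/-- The complex number `i√3`. -/
noncomputable def iSqrtThree : ℂ := Complex.I * (√3 : ℝ)

/-- The coefficient of `ζ ^ 2` in the quadratic equation for `ζ = e ^ (iα)`. -/
noncomputable def quadCoeff (N : ℕ) (M : ℤ) : ℂ :=
  (M : ℂ) ^ 2 * (-iSqrtThree - 1) + (N : ℂ) * (3 * iSqrtThree + 3)

/-- The coefficient of `ζ` in the quadratic equation for `ζ = e ^ (iα)`. -/
noncomputable def linCoeff (N : ℕ) (M : ℤ) : ℂ :=
  (M : ℂ) ^ 2 * (-iSqrtThree + 1) + (N : ℂ) * (-3 * iSqrtThree + 3)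

/-- The constant coefficient in the quadratic equation for `ζ = e ^ (iα)`. -/
noncomputable def constCoeff (N : ℕ) (M : ℤ) : ℂ :=
  2 * (M : ℂ) ^ 2 - 6 * (N : ℂ)

/-- The side ratio with the plus sign,
`((3N + M²) / (3N - M²) + √((9N - M²)(N - M²)) / (3N - M²)) / 2`. -/
noncomputable def ratioPlus (N : ℕ) (M : ℤ) : ℝ :=
  1 / 2 * ((3 * (N : ℝ) + (M : ℝ) ^ 2) / (3 * (N : ℝ) - (M : ℝ) ^ 2) +
    √((9 * (N : ℝ) - (M : ℝ) ^ 2) * ((N : ℝ) - (M : ℝ) ^ 2)) / (3 * (N : ℝ) - (M : ℝ) ^ 2))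

/-- The side ratio with the minus sign,
`((3N + M²) / (3N - M²) - √((9N - M²)(N - M²)) / (3N - M²)) / 2`. -/
noncomputable def ratioMinus (N : ℕ) (M : ℤ) : ℝ :=
  1 / 2 * ((3 * (N : ℝ) + (M : ℝ) ^ 2) / (3 * (N : ℝ) - (M : ℝ) ^ 2) -
    √((9 * (N : ℝ) - (M : ℝ) ^ 2) * ((N : ℝ) - (M : ℝ) ^ 2)) / (3 * (N : ℝ) - (M : ℝ) ^ 2))

open Filter Topology MeasureTheory
open Affine.Simplex

/-! Direct every edge of every tile counterclockwise and read its unit direction as a complex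
number. Since $\beta=\frac{2\pi}{3}-\alpha$, all these directions have the form
$z_0e^{i(m\alpha+n\pi/3)}$. Along one tile the direction turns by an exterior angle, which preserves
the parity of $m+n$; across a common edge it is negated, which adds $3$ to $n$ and flips the parity.
Because $\alpha/\pi$ is irrational, the parity depends on the direction alone (`HasParity.unique`).
It is therefore a 2-coloring, and every tile with an edge along the boundary of $ABC$ is black
(`Tiling.exists_coloring`).

Any two tiles are joined by a chain of adjacent tiles (`Tiling.connected`), so the color at $A$
determines the coloring. Only one tile contains $A$: the angles there sum to $\frac{\pi}{3}$, and
irrationality leaves room for just one (`Tiling.eq_of_mem_vertex`).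

Let $X$ be the side of $ABC$. In the sum of the tile perimeters, signed by color, interior edges
cancel and the boundary counts once, so $M(a+b+c)=3X$ (`Tiling.sum_sign_mul_perimeter`). Comparing
areas gives $Nab=X^2$ (`Tiling.card_mul_abs_signedArea`). With $c^2=a^2+b^2-ab$ these combine to
$M^2(a+b+c)=3N(a+b-c)$ (`linear_relation`), from which the quadratic equation, the side ratios and
the inequality follow by algebra; the inequality is strict because $a\ne b$. -/

/-! ### Barycentric coordinates and edge directions of a triangle. -/

/-- The cross product of two vectors of the plane. -/
def cross (u v : Plane) : ℝ := u 0 * v 1 - u 1 * v 0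

/-- The cross product of the edges at the vertex `0`: twice the signed area. -/
def Affine.Simplex.signedArea (t : Affine.Triangle ℝ Plane) : ℝ :=
  cross (t.points 1 - t.points 0) (t.points 2 - t.points 0)

/-- Barycentric coordinates with respect to a triangle. -/
noncomputable def Affine.Simplex.bary (t : Affine.Triangle ℝ Plane) (k : Fin 3) (x : Plane) : ℝ :=
  cross (t.points (k + 1) - x) (t.points (k + 2) - x) / t.signedArea

/-- `x` lies in the relative interior of the edge opposite the vertex `k`. -/
def Affine.Simplex.OnEdge (t : Affine.Triangle ℝ Plane) (k : Fin 3) (x : Plane) : Prop :=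
  t.bary k x = 0 ∧ 0 < t.bary (k + 1) x ∧ 0 < t.bary (k + 2) x

/-- The unit vector along the edge opposite the vertex `k`, in counterclockwise direction. -/
noncomputable def Affine.Simplex.edgeDir (t : Affine.Triangle ℝ Plane) (k : Fin 3) : Plane :=
  (t.signedArea / |t.signedArea| / dist (t.points (k + 1)) (t.points (k + 2))) •
    (t.points (k + 2) - t.points (k + 1))

lemma Plane.norm_sq (v : Plane) : ‖v‖ ^ 2 = v 0 ^ 2 + v 1 ^ 2 := by
  simp [EuclideanSpace.real_norm_sq_eq, Fin.sum_univ_two]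

lemma Plane.inner_eq (u v : Plane) : inner ℝ u v = u 0 * v 0 + u 1 * v 1 := by
  simp [PiLp.inner_apply, Fin.sum_univ_two, mul_comm]

lemma Plane.ext {u v : Plane} (h0 : u 0 = v 0) (h1 : u 1 = v 1) : u = v := by
  ext i; fin_cases i <;> assumption

lemma cross_smul_left (r : ℝ) (u v : Plane) : cross (r • u) v = r * cross u v := by
  simp [cross]; ring

lemma cross_smul_right (r : ℝ) (u v : Plane) : cross u (r • v) = r * cross u v := by
  simp [cross]; ring

lemma cross_same (u : Plane) : cross u u = 0 := by
  simp [cross]; ring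

namespace Affine.Simplex

variable (t : Affine.Triangle ℝ Plane)

lemma signedArea_ne_zero : t.signedArea ≠ 0 := by
  intro h
  have hi := t.independent
  rw [affineIndependent_iff_linearIndependent_vsub ℝ _ (0 : Fin 3)] at hi
  have h2 : LinearIndependent ℝ ![t.points 1 - t.points 0, t.points 2 - t.points 0] := by
    have := hi.comp (fun i : Fin 2 => (⟨i.succ, Fin.succ_ne_zero i⟩ : {x : Fin 3 // x ≠ 0}))
      (fun i j hij => by simpa using hij)
    have he : ((fun i : {x : Fin 3 // x ≠ 0} => t.points i -ᵥ t.points 0) ∘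
        fun i : Fin 2 => (⟨i.succ, Fin.succ_ne_zero i⟩ : {x : Fin 3 // x ≠ 0})) =
        ![t.points 1 - t.points 0, t.points 2 - t.points 0] := by
      ext i j
      fin_cases i <;> simp
    rw [he] at this
    exact this
  rw [LinearIndependent.pair_iff] at h2
  have h0 := t.independent.injective.ne (show (1 : Fin 3) ≠ 0 by decide)
  simp only [signedArea, cross] at h
  set u := t.points 1 - t.points 0
  set v := t.points 2 - t.points 0
  have hu0 : u 0 = 0 := by
    -- Both coordinates of $v_0u-u_0v$ vanish, the second because it is minus the cross product;
    -- likewise for $v_1u-u_1v$ below.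
    have := h2 (v 0) (-u 0) (Plane.ext (by simp; ring) (by simp; linarith))
    linarith [this.2]
  have hu1 : u 1 = 0 := by
    have := h2 (v 1) (-u 1) (Plane.ext (by simp; linarith) (by simp; ring))
    linarith [this.2]
  exact h0 (sub_eq_zero.1 (Plane.ext (u := u) (v := 0) (by simpa using hu0) (by simpa using hu1)))

lemma signedArea_cyclic (k : Fin 3) :
    cross (t.points (k + 1) - t.points k) (t.points (k + 2) - t.points k) = t.signedArea := by
  fin_cases k <;> simp [signedArea, cross] <;> ring_nf

lemma sum_bary (x : Plane) : t.bary 0 x + t.bary 1 x + t.bary 2 x = 1 := by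
  have h := t.signedArea_ne_zero
  simp only [bary]
  field_simp
  simp [signedArea, cross]
  ring

lemma sum_bary_cyclic (k : Fin 3) (x : Plane) :
    t.bary k x + t.bary (k + 1) x + t.bary (k + 2) x = 1 := by
  have := t.sum_bary x
  fin_cases k <;> simp <;> linarith

lemma sum_bary_smul (x : Plane) :
    t.bary 0 x • t.points 0 + t.bary 1 x • t.points 1 + t.bary 2 x • t.points 2 = x := by
  have h := t.signedArea_ne_zero
  apply Plane.ext <;>
  · simp only [bary, PiLp.add_apply, PiLp.smul_apply, smul_eq_mul]
    field_simp
    simp [signedArea, cross]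
    ring

lemma sum_bary_smul_cyclic (k : Fin 3) (x : Plane) :
    t.bary k x • t.points k + t.bary (k + 1) x • t.points (k + 1) +
      t.bary (k + 2) x • t.points (k + 2) = x := by
  have := t.sum_bary_smul x
  fin_cases k
  · exact this
  · refine Eq.trans ?_ this
    change t.bary 1 x • t.points 1 + t.bary 2 x • t.points 2 + t.bary 0 x • t.points 0 = _
    abel
  · refine Eq.trans ?_ this
    change t.bary 2 x • t.points 2 + t.bary 0 x • t.points 0 + t.bary 1 x • t.points 1 = _
    abel

lemma bary_add (k : Fin 3) (x v : Plane) :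
    t.bary k (x + v) =
      t.bary k x + cross (t.points (k + 2) - t.points (k + 1)) v / t.signedArea := by
  simp only [bary]
  rw [← add_div]
  congr 1
  simp [cross]
  ring

lemma bary_combination (k : Fin 3) (w : Fin 3 → ℝ) (hw : w 0 + w 1 + w 2 = 1) :
    t.bary k (w 0 • t.points 0 + w 1 • t.points 1 + w 2 • t.points 2) = w k := by
  have h := t.signedArea_ne_zero
  have h0 : w 0 = 1 - w 1 - w 2 := by linarith
  simp only [bary]
  rw [div_eq_iff h]
  fin_cases k <;> simp [signedArea, cross, h0] <;> ring

lemma bary_point_self (k : Fin 3) : t.bary k (t.points k) = 1 := by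
  rw [bary, signedArea_cyclic, div_self t.signedArea_ne_zero]

lemma bary_point_succ (k : Fin 3) : t.bary k (t.points (k + 1)) = 0 := by
  simp [bary, cross]

lemma bary_point_succ_succ (k : Fin 3) : t.bary k (t.points (k + 2)) = 0 := by
  simp [bary, cross]

lemma continuous_bary (k : Fin 3) : Continuous (t.bary k) := by
  unfold bary cross
  simp only [PiLp.sub_apply]
  fun_prop

lemma mem_setInterior_iff (I : Set ℝ) (x : Plane) :
    x ∈ t.setInterior I ↔ ∀ k, t.bary k x ∈ I := by
  constructor
  · rintro ⟨w, hw, hI, rfl⟩ k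
    rw [Finset.affineCombination_eq_linear_combination _ _ _ hw, Fin.sum_univ_three,
      bary_combination]
    · exact hI k
    · simpa [Fin.sum_univ_three] using hw
  · intro h
    have hw : ∑ i, (fun k => t.bary k x) i = 1 := by
      simpa [Fin.sum_univ_three] using t.sum_bary x
    refine ⟨fun k => t.bary k x, hw, h, ?_⟩
    rw [Finset.affineCombination_eq_linear_combination _ _ _ hw, Fin.sum_univ_three,
      sum_bary_smul]

lemma mem_closedInterior_iff (x : Plane) : x ∈ t.closedInterior ↔ ∀ k, 0 ≤ t.bary k x := by
  rw [Simplex.closedInterior, mem_setInterior_iff]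
  refine ⟨fun h k => (h k).1, fun h k => ⟨h k, ?_⟩⟩
  have := t.sum_bary_cyclic k x
  linarith [h (k + 1), h (k + 2)]

lemma mem_interior_iff (x : Plane) : x ∈ t.interior ↔ ∀ k, 0 < t.bary k x := by
  rw [Simplex.interior, mem_setInterior_iff]
  refine ⟨fun h k => (h k).1, fun h k => ⟨h k, ?_⟩⟩
  have := t.sum_bary_cyclic k x
  linarith [h (k + 1), h (k + 2)]

lemma bary_add_smul (k : Fin 3) (x v : Plane) (ε : ℝ) :
    t.bary k (x + ε • v) = t.bary k x + ε * (t.bary k (x + v) - t.bary k x) := by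
  rw [bary_add, bary_add, cross_smul_right]; ring

lemma dist_points_pos {i j : Fin 3} (h : i ≠ j) : 0 < dist (t.points i) (t.points j) :=
  dist_pos.2 (t.independent.injective.ne h)

lemma edge_ne (k : Fin 3) : k + 1 ≠ k + 2 := by fin_cases k <;> decide

lemma norm_edgeDir (k : Fin 3) : ‖t.edgeDir k‖ = 1 := by
  have h := abs_pos.2 t.signedArea_ne_zero
  have h2 := t.dist_points_pos (edge_ne k)
  rw [edgeDir, norm_smul, ← dist_eq_norm, dist_comm (t.points (k + 2))]
  simp only [norm_div, Real.norm_eq_abs, abs_abs, abs_of_pos h2]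
  field_simp

lemma edgeDir_sq (k : Fin 3) : t.edgeDir k 0 ^ 2 + t.edgeDir k 1 ^ 2 = 1 := by
  rw [← Plane.norm_sq, norm_edgeDir]; norm_num

/-- The slope of a barycentric coordinate. -/
lemma exists_slope (k : Fin 3) : ∃ c : ℝ, 0 < c ∧ ∀ x v : Plane,
    t.bary k (x + v) = t.bary k x + c * cross (t.edgeDir k) v := by
  have h := abs_pos.2 t.signedArea_ne_zero
  have h2 := t.dist_points_pos (edge_ne k)
  refine ⟨dist (t.points (k + 1)) (t.points (k + 2)) / |t.signedArea|, by positivity, ?_⟩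
  intro x v
  rw [bary_add, edgeDir, cross_smul_left]
  congr 1
  have h3 : |t.signedArea| * |t.signedArea| = t.signedArea * t.signedArea := abs_mul_abs_self _
  have h4 := t.signedArea_ne_zero
  field_simp
  rw [sq_abs]

lemma isOpen_interior : IsOpen t.interior := by
  have : t.interior = ⋂ k, t.bary k ⁻¹' Set.Ioi 0 := by
    ext x; simp [mem_interior_iff]
  rw [this]
  exact isOpen_iInter_of_finite fun k => isOpen_Ioi.preimage (t.continuous_bary k)

lemma interior_subset : t.interior ⊆ t.closedInterior := fun x hx =>
  (t.mem_closedInterior_iff x).2 fun k => ((t.mem_interior_iff x).1 hx k).le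

lemma OnEdge.mem_closedInterior {t : Affine.Triangle ℝ Plane} {k : Fin 3} {x : Plane}
    (h : t.OnEdge k x) : x ∈ t.closedInterior := by
  rw [mem_closedInterior_iff]
  obtain ⟨h0, h1, h2⟩ := h
  intro j
  have : j = k ∨ j = k + 1 ∨ j = k + 2 := by fin_cases k <;> fin_cases j <;> simp
  rcases this with rfl | rfl | rfl
  · exact h0.ge
  · exact h1.le
  · exact h2.le

lemma OnEdge.notMem_interior {t : Affine.Triangle ℝ Plane} {k : Fin 3} {x : Plane}
    (h : t.OnEdge k x) : x ∉ t.interior := fun hx =>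
  (((t.mem_interior_iff x).1 hx k).ne h.1.symm)

lemma OnEdge.unique {t : Affine.Triangle ℝ Plane} {k l : Fin 3} {x : Plane}
    (h : t.OnEdge k x) (h' : t.OnEdge l x) : k = l := by
  obtain ⟨h0, h1, h2⟩ := h
  obtain ⟨h0', h1', h2'⟩ := h'
  have : l = k ∨ l = k + 1 ∨ l = k + 2 := by fin_cases k <;> fin_cases l <;> simp
  rcases this with rfl | rfl | rfl
  · rfl
  · exact absurd h0' h1.ne'
  · exact absurd h0' h2.ne'

lemma eq_point_of_bary {k : Fin 3} {x : Plane} (h1 : t.bary (k + 1) x = 0)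
    (h2 : t.bary (k + 2) x = 0) : x = t.points k := by
  have h := t.sum_bary_cyclic k x
  have h' := t.sum_bary_smul_cyclic k x
  rw [h1, h2] at h h'
  simp only [zero_smul, add_zero] at h h'
  rw [h, one_smul] at h'
  exact h'.symm

lemma mem_interior_or_onEdge {x : Plane} (hx : x ∈ t.closedInterior)
    (hv : ∀ k, x ≠ t.points k) : x ∈ t.interior ∨ ∃ k, t.OnEdge k x := by
  rw [mem_closedInterior_iff] at hx
  by_cases h : ∃ k, t.bary k x = 0
  · right
    obtain ⟨k, hk⟩ := h
    refine ⟨k, hk, (hx _).lt_of_ne' fun h => ?_, (hx _).lt_of_ne' fun h => ?_⟩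
    · apply hv (k + 2)
      apply t.eq_point_of_bary
      · convert hk using 2; fin_cases k <;> decide
      · convert h using 2; fin_cases k <;> decide
    · apply hv (k + 1)
      apply t.eq_point_of_bary
      · convert h using 2; fin_cases k <;> decide
      · convert hk using 2; fin_cases k <;> decide
  · left
    push Not at h
    exact (t.mem_interior_iff x).2 fun k => (hx k).lt_of_ne' (h k)

lemma convex_closedInterior : Convex ℝ t.closedInterior := by
  rw [← Simplex.convexHull_eq_closedInterior]
  exact convex_convexHull _ _

/-- Edges are directed counterclockwise, so the triangle lies to the left of `edgeDir`, and a
positive cross product means that `v` points inward. -/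
lemma OnEdge.eventually_mem_interior {t : Affine.Triangle ℝ Plane} {k : Fin 3} {x v : Plane}
    (h : t.OnEdge k x) (hv : 0 < cross (t.edgeDir k) v) :
    ∀ᶠ ε : ℝ in 𝓝[>] 0, x + ε • v ∈ t.interior := by
  have hc : ∀ j, 0 < t.bary j x → ∀ᶠ ε : ℝ in 𝓝[>] 0, 0 < t.bary j (x + ε • v) := by
    intro j hj
    have : ContinuousAt (fun ε : ℝ => t.bary j (x + ε • v)) 0 :=
      ((t.continuous_bary j).comp (by fun_prop)).continuousAt
    exact (this.eventually (lt_mem_nhds (by simpa using hj))).filter_mono nhdsWithin_le_nhds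
  filter_upwards [hc _ h.2.1, hc _ h.2.2, self_mem_nhdsWithin] with ε h1 h2 h3
  obtain ⟨c, hc, hs⟩ := t.exists_slope k
  rw [mem_interior_iff]
  intro j
  have : j = k ∨ j = k + 1 ∨ j = k + 2 := by fin_cases k <;> fin_cases j <;> simp
  rcases this with rfl | rfl | rfl
  · rw [hs, h.1, cross_smul_right, zero_add]
    exact mul_pos hc (mul_pos h3 hv)
  · exact h1
  · exact h2

lemma eventually_notMem_closedInterior {t : Affine.Triangle ℝ Plane} {k : Fin 3} {x v : Plane}
    (h : t.bary k x = 0) (hv : cross (t.edgeDir k) v < 0) :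
    ∀ᶠ ε : ℝ in 𝓝[>] 0, x + ε • v ∉ t.closedInterior := by
  filter_upwards [self_mem_nhdsWithin] with ε h3 hmem
  obtain ⟨c, hc, hs⟩ := t.exists_slope k
  rw [mem_closedInterior_iff] at hmem
  have := hmem k
  rw [hs, h, cross_smul_right, zero_add] at this
  have : c * (ε * cross (t.edgeDir k) v) < 0 := mul_neg_of_pos_of_neg hc (mul_neg_of_pos_of_neg h3 hv)
  linarith

/-- If a coordinate of `t` vanished at an interior point of `s`, a small step along the outward
normal $(d_1,-d_0)$ of that edge direction $d$ would leave `t` while staying in `s`. -/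
lemma interior_subset_interior {s t : Affine.Triangle ℝ Plane}
    (h : s.closedInterior ⊆ t.closedInterior) : s.interior ⊆ t.interior := by
  intro x hx
  rw [mem_interior_iff]
  intro k
  have h0 := (t.mem_closedInterior_iff x).1 (h (s.interior_subset hx)) k
  refine h0.lt_of_ne' fun hk => ?_
  have hd := t.edgeDir_sq k
  have h1 : ∀ᶠ ε : ℝ in 𝓝[>] 0, x + ε • !₂[t.edgeDir k 1, -t.edgeDir k 0] ∉ t.closedInterior :=
    eventually_notMem_closedInterior hk (by simp [cross]; nlinarith)
  have h2 : ∀ᶠ ε : ℝ in 𝓝[>] 0, x + ε • !₂[t.edgeDir k 1, -t.edgeDir k 0] ∈ s.interior := by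
    have : ContinuousAt (fun ε : ℝ => x + ε • !₂[t.edgeDir k 1, -t.edgeDir k 0]) 0 := by fun_prop
    exact (this.eventually (s.isOpen_interior.mem_nhds (by simpa using hx))).filter_mono
      nhdsWithin_le_nhds
  obtain ⟨ε, h3, h4⟩ := (h1.and h2).exists
  exact h3 (h (s.interior_subset h4))

/-- From each point of a triangle one can move into its interior along a segment. -/
lemma exists_eventually_mem_interior {x : Plane} (hx : x ∈ t.closedInterior) :
    ∃ v : Plane, ∀ᶠ ε : ℝ in 𝓝[>] 0, x + ε • v ∈ t.interior := by
  set g : Plane := (1 / 3 : ℝ) • t.points 0 + (1 / 3 : ℝ) • t.points 1 + (1 / 3 : ℝ) • t.points 2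
  have hg : ∀ k, t.bary k g = 1 / 3 := fun k =>
    t.bary_combination k (fun _ => 1 / 3) (by norm_num)
  refine ⟨g - x, ?_⟩
  have : ∀ᶠ ε : ℝ in 𝓝[>] 0, ε < 1 := 
    nhdsWithin_le_nhds (gt_mem_nhds one_pos)
  filter_upwards [self_mem_nhdsWithin, this] with ε h1 h2
  rw [mem_interior_iff]
  intro k
  have h3 := (t.mem_closedInterior_iff x).1 hx k
  rw [bary_add_smul, add_sub_cancel, hg]
  have h1 : (0:ℝ) < ε := h1
  nlinarith

lemma interior_nonempty : t.interior.Nonempty := by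
  obtain ⟨v, hv⟩ := t.exists_eventually_mem_interior (Simplex.point_mem_closedInterior t 0)
  obtain ⟨ε, hε⟩ := hv.exists
  exact ⟨_, hε⟩

end Affine.Simplex

/-! ### Two triangles meeting at a point of their edges. -/

/-- Two triangles with disjoint interiors and a common point of their edges lie on opposite sides
of the common line. -/
lemma Affine.Simplex.OnEdge.edgeDir_eq_neg {s t : Affine.Triangle ℝ Plane} {k l : Fin 3} {x : Plane}
    (hs : s.OnEdge k x) (ht : t.OnEdge l x) (hd : Disjoint s.interior t.interior) :
    t.edgeDir l = -s.edgeDir k := by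
  by_contra hne
  have h1 := s.edgeDir_sq k
  have h2 := t.edgeDir_sq l
  set d := s.edgeDir k with hdk
  set e := t.edgeDir l with hel
  have hpos : 0 < (d 0 + e 0) ^ 2 + (d 1 + e 1) ^ 2 := by
    refine lt_of_le_of_ne (by positivity) fun h => hne ?_
    apply Plane.ext
    · simp; nlinarith
    · simp; nlinarith
  -- This is $d+e$ turned by a right angle; its cross product with $d$ and with $e$ is $1+d\cdot e$,
  -- positive unless $e=-d$. So `v` points into both triangles.
  set v : Plane := !₂[-(d 1 + e 1), d 0 + e 0] with hv
  have hs' := hs.eventually_mem_interior (v := v) (by simp [cross, hv, ← hdk]; nlinarith)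
  have ht' := ht.eventually_mem_interior (v := v) (by simp [cross, hv, ← hel]; nlinarith)
  obtain ⟨ε, h3, h4⟩ := (hs'.and ht').exists
  exact Set.disjoint_left.1 hd h3 h4

/-- If a triangle is contained in another one, and edges of both pass through a point, then the
triangles lie on the same side of the common line. -/
lemma Affine.Simplex.OnEdge.edgeDir_eq {s t : Affine.Triangle ℝ Plane} {k l : Fin 3} {x : Plane}
    (hs : s.OnEdge k x) (ht : t.OnEdge l x) (hd : s.closedInterior ⊆ t.closedInterior) :
    s.edgeDir k = t.edgeDir l := by
  by_contra hne
  have h1 := s.edgeDir_sq k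
  have h2 := t.edgeDir_sq l
  set d := s.edgeDir k with hdk
  set e := t.edgeDir l with hel
  have hpos : 0 < (d 0 - e 0) ^ 2 + (d 1 - e 1) ^ 2 := by
    refine lt_of_le_of_ne (by positivity) fun h => hne ?_
    apply Plane.ext
    · nlinarith
    · nlinarith
  -- This is $d-e$ turned by a right angle; the cross products are $1-d\cdot e>0$ with $d$ and its
  -- negative with $e$, so `v` enters `s` and leaves `t`.
  set v : Plane := !₂[-(d 1 - e 1), d 0 - e 0] with hv
  have hs' := hs.eventually_mem_interior (v := v) (by simp [cross, hv, ← hdk]; nlinarith)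
  have ht' := t.eventually_notMem_closedInterior (v := v) ht.1
    (by simp [cross, hv, ← hel]; nlinarith)
  obtain ⟨ε, h3, h4⟩ := (hs'.and ht').exists
  exact h4 (hd (s.interior_subset h3))

/-- Two triangles on opposite sides of a line through edges of both share a segment. -/
lemma Affine.Simplex.OnEdge.exists_segment {s t : Affine.Triangle ℝ Plane} {k l : Fin 3} {x : Plane}
    (hs : s.OnEdge k x) (ht : t.OnEdge l x) (h : t.edgeDir l = -s.edgeDir k) :
    ∃ P Q : Plane, P ≠ Q ∧ segment ℝ P Q ⊆ s.closedInterior ∩ t.closedInterior := by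
  have aux : ∀ {u : Affine.Triangle ℝ Plane} {m : Fin 3} {v : Plane}, u.OnEdge m x →
      cross (u.edgeDir m) v = 0 → ∀ᶠ ε : ℝ in 𝓝[>] 0, x + ε • v ∈ u.closedInterior := by
    intro u m v hu hv
    have hc : ∀ j, 0 < u.bary j x → ∀ᶠ ε : ℝ in 𝓝[>] 0, 0 < u.bary j (x + ε • v) := by
      intro j hj
      have : ContinuousAt (fun ε : ℝ => u.bary j (x + ε • v)) 0 :=
        ((u.continuous_bary j).comp (by fun_prop)).continuousAt
      exact (this.eventually (lt_mem_nhds (by simpa using hj))).filter_mono nhdsWithin_le_nhds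
    filter_upwards [hc _ hu.2.1, hc _ hu.2.2] with ε h1 h2
    obtain ⟨c, hc, hs⟩ := u.exists_slope m
    refine OnEdge.mem_closedInterior (k := m) ⟨?_, h1, h2⟩
    rw [hs, cross_smul_right, hv, hu.1]; ring
  have h1 := aux (v := s.edgeDir k) hs (cross_same _)
  have h2 := aux (v := s.edgeDir k) ht (by rw [h]; simp [cross]; ring)
  obtain ⟨ε, ⟨h1, h2⟩, h3⟩ := ((h1.and h2).and self_mem_nhdsWithin).exists
  have h3 : 0 < ε := h3
  refine ⟨x, x + ε • s.edgeDir k, fun he => ?_, Set.subset_inter ?_ ?_⟩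
  · have h4 : ε • s.edgeDir k = 0 := by simpa using he
    have h5 := s.norm_edgeDir k
    rw [(smul_eq_zero.1 h4).resolve_left h3.ne'] at h5
    simp at h5
  · exact s.convex_closedInterior.segment_subset hs.mem_closedInterior h1
  · exact t.convex_closedInterior.segment_subset ht.mem_closedInterior h2

lemma segment_infinite {P Q : Plane} (h : P ≠ Q) : (segment ℝ P Q).Infinite := by
  rw [segment_eq_image_lineMap]
  exact (Set.Icc_infinite one_pos).image (AffineMap.lineMap_injective ℝ h).injOn

/-! ### Local structure of a tiling away from the vertices, and connectedness. -/

namespace Tiling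

variable {Δ T : Affine.Triangle ℝ Plane} {N : ℕ} (τ : Tiling Δ T N)

/-- The vertices of the pieces of a tiling. -/
def vertices : Set Plane := ⋃ i, Set.range (τ.piece i).points

lemma finite_vertices : τ.vertices.Finite := Set.finite_iUnion fun _ => Set.finite_range _

lemma ne_point {x : Plane} (hx : x ∉ τ.vertices) (i : Fin N) (k : Fin 3) :
    x ≠ (τ.piece i).points k := by
  rintro rfl
  exact hx (Set.mem_iUnion.2 ⟨i, k, rfl⟩)

lemma piece_subset (i : Fin N) : (τ.piece i).closedInterior ⊆ Δ.closedInterior := by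
  rw [← τ.cover]
  exact Set.subset_iUnion (fun i => (τ.piece i).closedInterior) i

lemma exists_piece {x : Plane} (hx : x ∈ Δ.closedInterior) :
    ∃ i, x ∈ (τ.piece i).closedInterior := by
  rw [← τ.cover] at hx
  exact Set.mem_iUnion.1 hx

lemma notMem_of_mem_interior {i j : Fin N} (hij : i ≠ j) {x : Plane}
    (hx : x ∈ (τ.piece i).interior) : x ∉ (τ.piece j).closedInterior := by
  intro hj
  obtain ⟨v, hv⟩ := (τ.piece j).exists_eventually_mem_interior hj
  have h2 : ∀ᶠ ε : ℝ in 𝓝[>] 0, x + ε • v ∈ (τ.piece i).interior := by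
    have : ContinuousAt (fun ε : ℝ => x + ε • v) 0 := by fun_prop
    exact (this.eventually ((τ.piece i).isOpen_interior.mem_nhds (by simpa using hx))).filter_mono
      nhdsWithin_le_nhds
  obtain ⟨ε, h3, h4⟩ := (hv.and h2).exists
  exact Set.disjoint_left.1 (τ.disjoint i j hij) h4 h3

lemma exists_onEdge_of_mem_of_mem {i j : Fin N} (hij : i ≠ j) {x : Plane} (hx : x ∉ τ.vertices)
    (hi : x ∈ (τ.piece i).closedInterior) (hj : x ∈ (τ.piece j).closedInterior) :
    ∃ k, (τ.piece i).OnEdge k x :=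
  ((τ.piece i).mem_interior_or_onEdge hi (τ.ne_point hx i)).resolve_left
    fun h => τ.notMem_of_mem_interior hij h hj

lemma edgeDir_eq_neg {i j : Fin N} (hij : i ≠ j) {k l : Fin 3} {x : Plane}
    (hi : (τ.piece i).OnEdge k x) (hj : (τ.piece j).OnEdge l x) :
    (τ.piece j).edgeDir l = -(τ.piece i).edgeDir k :=
  hi.edgeDir_eq_neg hj (τ.disjoint i j hij)

lemma adjacent_of_onEdge {i j : Fin N} (hij : i ≠ j) {k l : Fin 3} {x : Plane}
    (hi : (τ.piece i).OnEdge k x) (hj : (τ.piece j).OnEdge l x) : τ.Adjacent i j :=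
  ⟨hij, hi.exists_segment hj (τ.edgeDir_eq_neg hij hi hj)⟩

/-- A segment is infinite and the vertices are finitely many, so the shared segment contains a point
that is no vertex of any piece. -/
lemma Adjacent.exists_onEdge {τ : Tiling Δ T N} {i j : Fin N} (h : τ.Adjacent i j) :
    ∃ k l x, (τ.piece i).OnEdge k x ∧ (τ.piece j).OnEdge l x := by
  obtain ⟨hij, P, Q, hPQ, hs⟩ := h
  obtain ⟨x, hx, hxv⟩ := (segment_infinite hPQ).exists_notMem_finite τ.finite_vertices
  obtain ⟨k, hk⟩ := τ.exists_onEdge_of_mem_of_mem hij hxv (hs hx).1 (hs hx).2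
  obtain ⟨l, hl⟩ := τ.exists_onEdge_of_mem_of_mem hij.symm hxv (hs hx).2 (hs hx).1
  exact ⟨k, l, x, hk, hl⟩

/-- A point on an edge of a piece in the interior of the tiled triangle lies on an edge of another
piece. -/
lemma exists_other {i : Fin N} {k : Fin 3} {x : Plane} (hx : x ∉ τ.vertices)
    (hi : (τ.piece i).OnEdge k x) (hΔ : x ∈ Δ.interior) :
    ∃ j, j ≠ i ∧ ∃ l, (τ.piece j).OnEdge l x := by
  by_contra! hno
  have hno' : ∀ j, j ≠ i → x ∉ (τ.piece j).closedInterior := by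
    intro j hj hmem
    obtain ⟨l, hl⟩ := τ.exists_onEdge_of_mem_of_mem hj hx hmem hi.mem_closedInterior
    exact hno j hj l hl
  set d := (τ.piece i).edgeDir k with hd
  have hd2 := (τ.piece i).edgeDir_sq k
  set v : Plane := !₂[d 1, -d 0] with hv
  have h1 := (τ.piece i).eventually_notMem_closedInterior (v := v) hi.1
    (by simp [cross, hv, ← hd]; nlinarith)
  have hc : ContinuousAt (fun ε : ℝ => x + ε • v) 0 := by fun_prop
  have h2 : ∀ᶠ ε : ℝ in 𝓝[>] 0, x + ε • v ∈ Δ.interior :=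
    (hc.eventually (Δ.isOpen_interior.mem_nhds (by simpa using hΔ))).filter_mono
      nhdsWithin_le_nhds
  have h3 : ∀ᶠ ε : ℝ in 𝓝[>] 0, ∀ j, j ≠ i → x + ε • v ∉ (τ.piece j).closedInterior := by
    rw [eventually_all]
    intro j
    rw [eventually_imp_distrib_left]
    intro hj
    exact (hc.eventually ((Affine.Simplex.isClosed_closedInterior (τ.piece j)).isOpen_compl.mem_nhds
      (by simpa using hno' j hj))).filter_mono nhdsWithin_le_nhds
  obtain ⟨ε, ⟨h4, h5⟩, h6⟩ := ((h1.and h2).and h3).exists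
  obtain ⟨j, hj⟩ := τ.exists_piece (Δ.interior_subset h5)
  by_cases hji : j = i
  · exact h4 (hji ▸ hj)
  · exact h6 j hji hj

/-- A point on an edge of the tiled triangle lies on an edge of exactly one piece, on
the same side. -/
lemma exists_onEdge_of_boundary {l : Fin 3} {x : Plane} (hx : x ∉ τ.vertices)
    (hl : Δ.OnEdge l x) : ∃ i k, (τ.piece i).OnEdge k x ∧ (τ.piece i).edgeDir k = Δ.edgeDir l ∧
      ∀ j, x ∈ (τ.piece j).closedInterior → j = i := by
  obtain ⟨i, hi⟩ := τ.exists_piece hl.mem_closedInterior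
  have key : ∀ j, x ∈ (τ.piece j).closedInterior →
      ∃ k, (τ.piece j).OnEdge k x ∧ (τ.piece j).edgeDir k = Δ.edgeDir l := by
    intro j hj
    obtain ⟨k, hk⟩ := ((τ.piece j).mem_interior_or_onEdge hj (τ.ne_point hx j)).resolve_left
      fun h => hl.notMem_interior (interior_subset_interior (τ.piece_subset j) h)
    exact ⟨k, hk, hk.edgeDir_eq hl (τ.piece_subset j)⟩
  obtain ⟨k, hk, hd⟩ := key i hi
  refine ⟨i, k, hk, hd, fun j hj => ?_⟩
  by_contra hij
  obtain ⟨m, hm, hd'⟩ := key j hj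
  -- Two pieces here would have opposite edge directions, yet both equal that of `Δ`; a unit vector
  -- is not its own negative.
  have h := τ.edgeDir_eq_neg hij hm hk
  rw [hd, hd'] at h
  have h0 := congrArg (fun v : Plane => v 0) h
  have h1 := congrArg (fun v : Plane => v 1) h
  simp only [PiLp.neg_apply] at h0 h1
  have := Δ.edgeDir_sq l
  nlinarith

lemma volume_line_eq_zero {p v : Plane} :
    volume ((affineSpan ℝ {p, v} : AffineSubspace ℝ Plane) : Set Plane) = 0 := by
  apply Measure.addHaar_affineSubspace
  intro h
  have h1 := (collinear_pair ℝ p v)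
  rw [collinear_iff_finrank_le_one, ← direction_affineSpan, h, AffineSubspace.direction_top,
    finrank_top] at h1
  simp at h1

/-- Any two pieces are connected by a chain of adjacent pieces. -/
lemma connected (i j : Fin N) : Relation.ReflTransGen τ.Adjacent i j := by
  have hvol : ∀ i, volume (τ.piece i).interior ≠ 0 := fun i =>
    ((τ.piece i).isOpen_interior.measure_pos _ (τ.piece i).interior_nonempty).ne'
  obtain ⟨p, hp, hpv⟩ : ∃ p ∈ (τ.piece i).interior, p ∉ τ.vertices := by
    by_contra! h
    exact hvol i (measure_mono_null h (τ.finite_vertices.measure_zero _))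
  -- With `q` off the finitely many lines through `p` and a vertex, the segment from `p` to `q`
  -- avoids all vertices.
  obtain ⟨q, hq, hqv⟩ : ∃ q ∈ (τ.piece j).interior, ∀ v ∈ τ.vertices,
      q ∉ affineSpan ℝ {p, v} := by
    by_contra! h
    refine hvol j (measure_mono_null (t := ⋃ v ∈ τ.vertices,
      ((affineSpan ℝ {p, v} : AffineSubspace ℝ Plane) : Set Plane)) (fun x hx => ?_) ?_)
    · obtain ⟨v, hv, hvx⟩ := h x hx
      exact Set.mem_iUnion₂.2 ⟨v, hv, hvx⟩
    · exact (measure_biUnion_null_iff τ.finite_vertices.countable).2 fun v _ => volume_line_eq_zero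
  have hseg : ∀ x ∈ segment ℝ p q, x ∉ τ.vertices := by
    intro x hx hxv
    apply hqv x hxv
    have hxp : x ≠ p := by rintro rfl; exact hpv hxv
    rw [segment_eq_image_lineMap] at hx
    obtain ⟨r, -, rfl⟩ := hx
    have hr : r ≠ 0 := by rintro rfl; simp at hxp
    have : AffineMap.lineMap p (AffineMap.lineMap p q r) r⁻¹ = q := by
      rw [AffineMap.lineMap_lineMap_right, inv_mul_cancel₀ hr, AffineMap.lineMap_apply_one]
    rw [← this]
    nth_rewrite 1 [this]
    exact AffineMap.lineMap_mem_affineSpan_pair _ _ _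
  by_contra hcon
  -- The pieces reachable from `i` and the unreachable ones form two closed sets covering the
  -- connected segment. They meet at a point that is not a vertex, where a reachable and an
  -- unreachable piece would be adjacent.
  set S : Set Plane := ⋃ m ∈ {m | Relation.ReflTransGen τ.Adjacent i m}, (τ.piece m).closedInterior
  set S' : Set Plane := ⋃ m ∈ {m | ¬ Relation.ReflTransGen τ.Adjacent i m},
    (τ.piece m).closedInterior
  have hS : IsClosed S := (Set.toFinite _).isClosed_biUnion
    fun m _ => (Affine.Simplex.isClosed_closedInterior (τ.piece m))
  have hS' : IsClosed S' := (Set.toFinite _).isClosed_biUnion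
    fun m _ => (Affine.Simplex.isClosed_closedInterior (τ.piece m))
  have hpΔ := τ.piece_subset i ((τ.piece i).interior_subset hp)
  have hqΔ := τ.piece_subset j ((τ.piece j).interior_subset hq)
  obtain ⟨x, hx, hxS, hxS'⟩ := isPreconnected_closed_iff.1
    (convex_segment p q).isPreconnected S S' hS hS' (by
      intro x hx
      obtain ⟨m, hm⟩ := τ.exists_piece (Δ.convex_closedInterior.segment_subset hpΔ hqΔ hx)
      by_cases h : Relation.ReflTransGen τ.Adjacent i m
      · exact Or.inl (Set.mem_biUnion (x := m) h hm)
      · exact Or.inr (Set.mem_biUnion (x := m) h hm))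
    ⟨p, left_mem_segment ℝ p q, Set.mem_biUnion (x := i) Relation.ReflTransGen.refl
      ((τ.piece i).interior_subset hp)⟩
    ⟨q, right_mem_segment ℝ p q, Set.mem_biUnion (x := j) hcon ((τ.piece j).interior_subset hq)⟩
  obtain ⟨m, hm, hmx⟩ := Set.mem_iUnion₂.1 hxS
  obtain ⟨n, hn, hnx⟩ := Set.mem_iUnion₂.1 hxS'
  have hmn : m ≠ n := by rintro rfl; exact hn hm
  obtain ⟨k, hk⟩ := τ.exists_onEdge_of_mem_of_mem hmn (hseg x hx) hmx hnx
  obtain ⟨l, hl⟩ := τ.exists_onEdge_of_mem_of_mem hmn.symm (hseg x hx) hnx hmx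
  exact hn (hm.tail (τ.adjacent_of_onEdge hmn hk hl))

end Tiling

/-! ### Directions as complex numbers, and the parity invariant. -/

/-- The identification of the plane with the complex numbers. -/
noncomputable def Plane.toComplex (v : Plane) : ℂ := ⟨v 0, v 1⟩

lemma Plane.toComplex_neg (v : Plane) : (-v).toComplex = -v.toComplex := by
  apply Complex.ext <;> simp [Plane.toComplex]

lemma Fin.three_add_one_add_one (k : Fin 3) : k + 1 + 1 = k + 2 := by fin_cases k <;> rfl
lemma Fin.three_add_one_add_two (k : Fin 3) : k + 1 + 2 = k := by fin_cases k <;> rfl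
lemma Fin.three_add_two_add_one (k : Fin 3) : k + 2 + 1 = k := by fin_cases k <;> rfl
lemma Fin.three_add_two_add_two (k : Fin 3) : k + 2 + 2 = k + 1 := by fin_cases k <;> rfl

/-- The relative interior of an edge is an open segment. -/
lemma Affine.Simplex.setOf_onEdge (t : Affine.Triangle ℝ Plane) (k : Fin 3) :
    {x | t.OnEdge k x} = openSegment ℝ (t.points (k + 1)) (t.points (k + 2)) := by
  ext x
  constructor
  · rintro ⟨h0, h1, h2⟩
    have h3 := t.sum_bary_cyclic k x
    have h4 := t.sum_bary_smul_cyclic k x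
    rw [h0] at h3 h4
    exact ⟨_, _, h1, h2, by linarith, by simpa using h4⟩
  · rintro ⟨a, b, ha, hb, hab, rfl⟩
    have hcr : ∀ j, t.bary j (a • t.points (k + 1) + b • t.points (k + 2)) =
        a * t.bary j (t.points (k + 1)) + b * t.bary j (t.points (k + 2)) := by
      intro j
      have ha' : a = 1 - b := by linarith
      have : a • t.points (k + 1) + b • t.points (k + 2) =
          t.points (k + 1) + b • (t.points (k + 2) - t.points (k + 1)) := by
        rw [ha']; module
      rw [this, bary_add_smul, add_sub_cancel, ha']
      ring
    have e1 := t.bary_point_self (k + 1)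
    have e2 := t.bary_point_succ (k + 1)
    have e3 := t.bary_point_succ_succ (k + 2)
    have e4 := t.bary_point_self (k + 2)
    rw [Fin.three_add_one_add_one] at e2
    rw [Fin.three_add_two_add_two] at e3
    refine ⟨?_, ?_, ?_⟩
    · rw [hcr, bary_point_succ, bary_point_succ_succ]; ring
    · rw [hcr, e1, e2]; simpa using ha
    · rw [hcr, e3, e4]; simpa using hb

lemma Affine.Simplex.infinite_onEdge (t : Affine.Triangle ℝ Plane) (k : Fin 3) :
    {x | t.OnEdge k x}.Infinite := by
  rw [setOf_onEdge, openSegment_eq_image_lineMap]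
  exact (Set.Ioo_infinite one_pos).image (AffineMap.lineMap_injective ℝ
    (t.independent.injective.ne (edge_ne k))).injOn

lemma Affine.Simplex.edgeDir_succ (t : Affine.Triangle ℝ Plane) (k : Fin 3) :
    t.edgeDir (k + 1) = (t.signedArea / |t.signedArea| / dist (t.points (k + 2)) (t.points k)) •
      (t.points k - t.points (k + 2)) := by
  fin_cases k <;> rfl

lemma Affine.Simplex.inner_edgeDir (t : Affine.Triangle ℝ Plane) (k : Fin 3) :
    inner ℝ (t.edgeDir k) (t.edgeDir (k + 1)) =
      -Real.cos (∠ (t.points (k + 1)) (t.points (k + 2)) (t.points k)) := by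
  have h := t.signedArea_ne_zero
  have h1 := t.dist_points_pos (edge_ne k)
  have h2 := t.dist_points_pos (i := k + 2) (j := k) (by fin_cases k <;> decide)
  rw [EuclideanGeometry.angle, InnerProductGeometry.cos_angle, edgeDir_succ, edgeDir]
  simp only [vsub_eq_sub]
  rw [← dist_eq_norm, ← dist_eq_norm, dist_comm (t.points k), inner_smul_left, inner_smul_right,
    ← neg_sub, inner_neg_left]
  have h3 : |t.signedArea| ^ 2 = t.signedArea ^ 2 := sq_abs _
  have h4 := abs_pos.2 h
  simp only [conj_trivial]
  field_simp
  rw [h3]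

/-- Consecutive edges differ by a rotation by the exterior angle. -/
lemma Affine.Simplex.toComplex_edgeDir (t : Affine.Triangle ℝ Plane) (k : Fin 3) {θ : ℝ}
    (hθ : ∠ (t.points (k + 1)) (t.points (k + 2)) (t.points k) = θ) :
    (t.edgeDir (k + 1)).toComplex = (t.edgeDir k).toComplex * -Complex.exp (Complex.I * θ) ∨
    (t.edgeDir (k + 1)).toComplex =
      (t.edgeDir k).toComplex * -Complex.exp (Complex.I * (-θ : ℝ)) := by
  have h1 := t.edgeDir_sq k
  have h2 := t.edgeDir_sq (k + 1)
  have h3 := t.inner_edgeDir k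
  rw [hθ, Plane.inner_eq] at h3
  have h4 := Real.sin_sq_add_cos_sq θ
  rw [mul_comm Complex.I, mul_comm Complex.I]
  simp only [Plane.toComplex, Complex.ext_iff, Complex.mul_re, Complex.mul_im, Complex.neg_re,
    Complex.neg_im, Complex.exp_ofReal_mul_I_re, Complex.exp_ofReal_mul_I_im, Real.cos_neg,
    Real.sin_neg]
  generalize t.edgeDir k 0 = a at *
  generalize t.edgeDir k 1 = b at *
  generalize t.edgeDir (k + 1) 0 = c at *
  generalize t.edgeDir (k + 1) 1 = d at *
  generalize Real.cos θ = p at *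
  generalize Real.sin θ = q at *
  -- Lagrange's identity: the cross product of two unit vectors with inner product $-\cos\theta$ is
  -- $\pm\sin\theta$. The sign may stay open, since both rotations have the same effect on the
  -- parity.
  have h5 : (a * d - b * c - q) * (a * d - b * c + q) = 0 := by
    have : (a * d - b * c) ^ 2 + (a * c + b * d) ^ 2 = (a ^ 2 + b ^ 2) * (c ^ 2 + d ^ 2) := by ring
    rw [h3, h1, h2] at this
    linarith
  have hc : c = a * (a * c + b * d) - b * (a * d - b * c) := by linear_combination -c * h1
  have hd : d = a * (a * d - b * c) + b * (a * c + b * d) := by linear_combination -d * h1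
  rcases mul_eq_zero.1 h5 with h | h
  · right
    have h' : a * d - b * c = q := by linarith
    rw [h', h3] at hc hd
    constructor <;> linarith
  · left
    have h' : a * d - b * c = -q := by linarith
    rw [h', h3] at hc hd
    constructor <;> linarith

/-- `z` arises from `z₀` by a rotation by `m * α + n * (π / 3)`, with `m + n` of parity `s`. -/
def HasParity (α : ℝ) (z₀ : ℂ) (s : ZMod 2) (z : ℂ) : Prop :=
  ∃ m n : ℤ, ((m + n : ℤ) : ZMod 2) = s ∧
    z = z₀ * Complex.exp (Complex.I * (m * α + n * (π / 3) : ℝ))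

namespace HasParity

variable {α : ℝ} {z₀ z : ℂ} {s s' : ZMod 2}

lemma refl (α : ℝ) (z₀ : ℂ) : HasParity α z₀ 0 z₀ := ⟨0, 0, by simp, by simp⟩

lemma mul_exp (h : HasParity α z₀ s z) (m n : ℤ) :
    HasParity α z₀ (s + ((m + n : ℤ) : ZMod 2))
      (z * Complex.exp (Complex.I * (m * α + n * (π / 3) : ℝ))) := by
  obtain ⟨m', n', hs, rfl⟩ := h
  refine ⟨m' + m, n' + n, ?_, ?_⟩
  · rw [← hs]; push_cast; ring
  · rw [mul_assoc, ← Complex.exp_add]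
    congr 2
    push_cast
    ring

lemma neg_exp_eq (θ : ℝ) :
    -Complex.exp (Complex.I * θ) = Complex.exp (Complex.I * (θ + π : ℝ)) := by
  rw [Complex.ofReal_add, mul_add, Complex.exp_add, mul_comm Complex.I (π : ℂ), Complex.exp_pi_mul_I]
  ring

/-- $-1=e^{3i\pi/3}$, and $3$ is odd. -/
lemma neg (h : HasParity α z₀ s z) : HasParity α z₀ (s + 1) (-z) := by
  convert h.mul_exp 0 3 using 1
  · congr 1
  · rw [← mul_neg_one]
    congr 1
    have := neg_exp_eq 0
    simp only [Complex.ofReal_zero, mul_zero, Complex.exp_zero, zero_add] at this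
    rw [this]
    congr 3
    push_cast
    ring

/-- Turning by $\theta+\pi$ changes $(m,n)$ by $(1,3)$, $(-1,5)$ or $(0,4)$ for $\theta=\alpha,\
\frac{2\pi}{3}-\alpha,\ \frac{\pi}{3}$: always an even total. -/
lemma rotate {β θ : ℝ} (hαβ : α + β = 2 * π / 3) (hθ : θ = α ∨ θ = β ∨ θ = π / 3)
    (h : HasParity α z₀ s z) : HasParity α z₀ s (z * -Complex.exp (Complex.I * θ)) := by
  rw [neg_exp_eq]
  rcases hθ with rfl | rfl | rfl
  · convert h.mul_exp 1 3 using 1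
    · rw [show ((1 + 3 : ℤ) : ZMod 2) = 0 from rfl, add_zero]
    · congr 4; push_cast; ring
  · convert h.mul_exp (-1) 5 using 1
    · rw [show ((-1 + 5 : ℤ) : ZMod 2) = 0 from rfl, add_zero]
    · congr 4; push_cast; linarith
  · convert h.mul_exp 0 4 using 1
    · rw [show ((0 + 4 : ℤ) : ZMod 2) = 0 from rfl, add_zero]
    · congr 4; push_cast; ring

lemma rotate_neg {β θ : ℝ} (hαβ : α + β = 2 * π / 3) (hθ : θ = α ∨ θ = β ∨ θ = π / 3)
    (h : HasParity α z₀ s z) : HasParity α z₀ s (z * -Complex.exp (Complex.I * (-θ : ℝ))) := by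
  rw [neg_exp_eq]
  rcases hθ with rfl | rfl | rfl
  · convert h.mul_exp (-1) 3 using 1
    · rw [show ((-1 + 3 : ℤ) : ZMod 2) = 0 from rfl, add_zero]
    · congr 4; push_cast; ring
  · convert h.mul_exp 1 1 using 1
    · rw [show ((1 + 1 : ℤ) : ZMod 2) = 0 from rfl, add_zero]
    · congr 4; push_cast; linarith
  · convert h.mul_exp 0 2 using 1
    · rw [show ((0 + 2 : ℤ) : ZMod 2) = 0 from rfl, add_zero]
    · congr 4; push_cast; ring

/-- Irrationality of $\alpha/\pi$ forces $m=m'$; then $n$ and $n'$ differ by a multiple of $6$,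
which is even. -/
lemma unique (hz : z₀ ≠ 0) (hα : ∀ q : ℚ, α ≠ q * π) (h : HasParity α z₀ s z)
    (h' : HasParity α z₀ s' z) : s = s' := by
  obtain ⟨m, n, rfl, rfl⟩ := h
  obtain ⟨m', n', rfl, he⟩ := h'
  obtain ⟨k, hk⟩ := Complex.exp_eq_exp_iff_exists_int.1 (mul_left_cancel₀ hz he)
  have hr : m * α + n * (π / 3) = m' * α + n' * (π / 3) + k * (2 * π) := by
    have := congrArg Complex.im hk
    simpa using this
  have hm : m = m' := by
    by_contra hne
    have hne' : (m : ℝ) - m' ≠ 0 := sub_ne_zero.2 (by exact_mod_cast hne)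
    apply hα ((n' - n + 6 * k) / (3 * (m - m')))
    push_cast
    field_simp
    linarith
  subst hm
  have hn : (n : ℝ) = n' + 6 * k := by
    have := Real.pi_pos
    have h1 : (n - n' - 6 * k) * π = 0 := by linarith
    have := (mul_eq_zero.1 h1).resolve_right this.ne'
    linarith
  have hn' : n = n' + 6 * k := by exact_mod_cast hn
  rw [hn', ← sub_eq_zero, ← Int.cast_sub, ZMod.intCast_zmod_eq_zero_iff_dvd]
  exact ⟨3 * k, by push_cast; ring⟩

end HasParity

lemma Affine.Simplex.toComplex_edgeDir_ne_zero (t : Affine.Triangle ℝ Plane) (k : Fin 3) :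
    (t.edgeDir k).toComplex ≠ 0 := by
  intro h
  have h0 : t.edgeDir k 0 = 0 := congrArg Complex.re h
  have h1 : t.edgeDir k 1 = 0 := congrArg Complex.im h
  have := t.edgeDir_sq k
  rw [h0, h1] at this
  norm_num at this

lemma Affine.Simplex.hasParity_edgeDir {t : Affine.Triangle ℝ Plane} {α β : ℝ} {z₀ : ℂ} {s : ZMod 2}
    (hαβ : α + β = 2 * π / 3)
    (ht : ∀ k, ∠ (t.points (k + 1)) (t.points (k + 2)) (t.points k) = α ∨
      ∠ (t.points (k + 1)) (t.points (k + 2)) (t.points k) = β ∨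
      ∠ (t.points (k + 1)) (t.points (k + 2)) (t.points k) = π / 3)
    {k : Fin 3} (hk : HasParity α z₀ s (t.edgeDir k).toComplex) (l : Fin 3) :
    HasParity α z₀ s (t.edgeDir l).toComplex := by
  have step : ∀ k, HasParity α z₀ s (t.edgeDir k).toComplex →
      HasParity α z₀ s (t.edgeDir (k + 1)).toComplex := by
    intro k hk
    rcases t.toComplex_edgeDir k rfl with h | h <;> rw [h]
    · exact hk.rotate hαβ (ht k)
    · exact hk.rotate_neg hαβ (ht k)
  have : l = k ∨ l = k + 1 ∨ l = k + 1 + 1 := by fin_cases k <;> fin_cases l <;> simp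
  rcases this with rfl | rfl | rfl
  · exact hk
  · exact step _ hk
  · exact step _ (step _ hk)

/-! ### The coloring by parity. -/

namespace Tiling

variable {Δ T : Affine.Triangle ℝ Plane} {N : ℕ} (τ : Tiling Δ T N)

/-- The directions of the edges yield a coloring for which all pieces at the boundary are black. -/
theorem exists_coloring (hΔ : Δ.Equilateral) {α β : ℝ} (hαβ : α + β = 2 * π / 3)
    (hα : ∀ q : ℚ, α ≠ q * π)
    (hang : ∀ i k, ∠ ((τ.piece i).points (k + 1)) ((τ.piece i).points (k + 2))
        ((τ.piece i).points k) = α ∨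
      ∠ ((τ.piece i).points (k + 1)) ((τ.piece i).points (k + 2)) ((τ.piece i).points k) = β ∨
      ∠ ((τ.piece i).points (k + 1)) ((τ.piece i).points (k + 2)) ((τ.piece i).points k) = π / 3) :
    ∃ κ : Fin N → Bool, (∀ i j, τ.Adjacent i j → κ i ≠ κ j) ∧
      ∀ i k l, (τ.piece i).edgeDir k = Δ.edgeDir l → κ i = true := by
  set z₀ := (Δ.edgeDir 0).toComplex with hz
  have hz₀ : z₀ ≠ 0 := Δ.toComplex_edgeDir_ne_zero 0
  have hΔ' : ∀ l, HasParity α z₀ 0 (Δ.edgeDir l).toComplex := by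
    refine hasParity_edgeDir hαβ (fun k => Or.inr (Or.inr ?_)) (HasParity.refl _ _)
    exact hΔ.angle_eq_pi_div_three (by fin_cases k <;> decide) (by fin_cases k <;> decide)
      (by fin_cases k <;> decide)
  have hadj : ∀ i j s, τ.Adjacent i j → (∀ k, HasParity α z₀ s ((τ.piece i).edgeDir k).toComplex) →
      ∀ k, HasParity α z₀ (s + 1) ((τ.piece j).edgeDir k).toComplex := by
    intro i j s hij hi k
    obtain ⟨k', l, x, hk, hl⟩ := hij.exists_onEdge
    refine hasParity_edgeDir hαβ (hang j) (k := l) ?_ k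
    rw [τ.edgeDir_eq_neg hij.1 hk hl, Plane.toComplex_neg]
    exact (hi k').neg
  have hall : ∀ i, ∃ s, ∀ k, HasParity α z₀ s ((τ.piece i).edgeDir k).toComplex := by
    -- A piece on the boundary has parity $0$; the parity then spreads to all pieces along chains of
    -- adjacent ones.
    obtain ⟨x, hx, hxv⟩ := (Δ.infinite_onEdge 0).exists_notMem_finite τ.finite_vertices
    obtain ⟨i₀, k, hk, hd, -⟩ := τ.exists_onEdge_of_boundary hxv hx
    intro i
    induction τ.connected i₀ i with
    | refl => exact ⟨0, hasParity_edgeDir hαβ (hang i₀) (k := k) (hd ▸ hΔ' 0)⟩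
    | tail _ h ih =>
      obtain ⟨s, hs⟩ := ih
      exact ⟨s + 1, hadj _ _ s h hs⟩
  choose s hs using hall
  refine ⟨fun i => decide (s i = 0), fun i j hij => ?_, fun i k l hd => ?_⟩
  · have h := HasParity.unique hz₀ hα (hadj i j _ hij (hs i) 0) (hs j 0)
    have : ∀ a b : ZMod 2, a + 1 = b → decide (a = 0) ≠ decide (b = 0) := by decide
    exact this _ _ h
  · have h := hs i k
    rw [hd] at h
    simpa using HasParity.unique hz₀ hα h (hΔ' l)

end Tiling

/-! ### Polar coordinates at the vertex $A$, and uniqueness of the tile there. -/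

lemma Affine.Simplex.bary_affine (s : Affine.Triangle ℝ Plane) (k : Fin 3) {a b c : ℝ}
    (p q r : Plane) (h : a + b + c = 1) :
    s.bary k (a • p + b • q + c • r) = a * s.bary k p + b * s.bary k q + c * s.bary k r := by
  have h0 : a = 1 - b - c := by linarith
  simp only [bary, cross, h0]
  rw [← mul_div_assoc, ← mul_div_assoc, ← mul_div_assoc, ← add_div, ← add_div]
  congr 1
  simp
  ring

lemma Affine.Simplex.bary_vertex_add (t : Affine.Triangle ℝ Plane) (m : Fin 3) (x y : ℝ) :
    t.bary m (t.points m + (x • (t.points (m + 1) - t.points m) +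
        y • (t.points (m + 2) - t.points m))) = 1 - x - y ∧
      t.bary (m + 1) (t.points m + (x • (t.points (m + 1) - t.points m) +
        y • (t.points (m + 2) - t.points m))) = x ∧
      t.bary (m + 2) (t.points m + (x • (t.points (m + 1) - t.points m) +
        y • (t.points (m + 2) - t.points m))) = y := by
  have h : t.points m + (x • (t.points (m + 1) - t.points m) +
      y • (t.points (m + 2) - t.points m)) =
      (1 - x - y) • t.points m + x • t.points (m + 1) + y • t.points (m + 2) := by module
  have e1 := t.bary_point_succ (m + 1)
  have e2 := t.bary_point_succ_succ (m + 1)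
  have e3 := t.bary_point_succ (m + 2)
  have e4 := t.bary_point_succ_succ (m + 2)
  rw [Fin.three_add_one_add_one] at e1
  rw [Fin.three_add_one_add_two] at e2
  rw [Fin.three_add_two_add_one] at e3
  rw [Fin.three_add_two_add_two] at e4
  rw [h, bary_affine _ _ _ _ _ (by ring), bary_affine _ _ _ _ _ (by ring),
    bary_affine _ _ _ _ _ (by ring), e1, e2, e3, e4]
  simp only [bary_point_self, bary_point_succ, bary_point_succ_succ]
  refine ⟨?_, ?_, ?_⟩ <;> ring

/-- At `p`, the set `I` looks like the open and the set `K` like the closed cone spanned by the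
directions to `q₁` and `q₂`. -/
def IsLocalCone (I K : Set Plane) (p q₁ q₂ : Plane) : Prop :=
  ∀ x y : ℝ, (0 < x → 0 < y →
      ∀ᶠ ρ : ℝ in 𝓝[>] 0, p + ρ • (x • (q₁ - p) + y • (q₂ - p)) ∈ I) ∧
    (0 ≤ x → 0 ≤ y → ∀ᶠ ρ : ℝ in 𝓝[>] 0, p + ρ • (x • (q₁ - p) + y • (q₂ - p)) ∈ K) ∧
    ∀ ρ : ℝ, 0 < ρ → p + ρ • (x • (q₁ - p) + y • (q₂ - p)) ∈ K → 0 ≤ x ∧ 0 ≤ y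

lemma IsLocalCone.symm {I K : Set Plane} {p q₁ q₂ : Plane} (h : IsLocalCone I K p q₁ q₂) :
    IsLocalCone I K p q₂ q₁ := by
  intro x y
  obtain ⟨h1, h2, h3⟩ := h y x
  rw [add_comm (y • (q₁ - p))] at h1 h2 h3
  exact ⟨fun a b => h1 b a, fun a b => h2 b a, fun ρ hρ hm => (h3 ρ hρ hm).symm⟩

lemma Affine.Simplex.isLocalCone (t : Affine.Triangle ℝ Plane) (m : Fin 3) :
    IsLocalCone t.interior t.closedInterior (t.points m) (t.points (m + 1))
      (t.points (m + 2)) := by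
  have hj : ∀ j, j = m ∨ j = m + 1 ∨ j = m + 2 := by
    intro j; fin_cases m <;> fin_cases j <;> simp
  intro x y
  have hb : ∀ ρ : ℝ, _ := fun ρ => t.bary_vertex_add m (ρ * x) (ρ * y)
  simp only [mul_smul, ← smul_add] at hb
  have hsmall : ∀ᶠ ρ : ℝ in 𝓝[>] 0, 0 < 1 - ρ * x - ρ * y := by
    have : ContinuousAt (fun ρ : ℝ => 1 - ρ * x - ρ * y) 0 := by fun_prop
    exact (this.eventually (lt_mem_nhds (by simp))).filter_mono nhdsWithin_le_nhds
  refine ⟨fun hx hy => ?_, fun hx hy => ?_, fun ρ hρ hm => ?_⟩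
  · filter_upwards [hsmall, self_mem_nhdsWithin] with ρ h1 h2
    have h2 : 0 < ρ := h2
    obtain ⟨b0, b1, b2⟩ := hb ρ
    rw [mem_interior_iff]
    intro j
    rcases hj j with rfl | rfl | rfl
    · rwa [b0]
    · rw [b1]; positivity
    · rw [b2]; positivity
  · filter_upwards [hsmall, self_mem_nhdsWithin] with ρ h1 h2
    have h2 : 0 < ρ := h2
    obtain ⟨b0, b1, b2⟩ := hb ρ
    rw [mem_closedInterior_iff]
    intro j
    rcases hj j with rfl | rfl | rfl
    · rw [b0]; exact h1.le
    · rw [b1]; positivity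
    · rw [b2]; positivity
  · obtain ⟨b0, b1, b2⟩ := hb ρ
    rw [mem_closedInterior_iff] at hm
    have h1 := hm (m + 1)
    have h2 := hm (m + 2)
    rw [b1] at h1
    rw [b2] at h2
    exact ⟨nonneg_of_mul_nonneg_right h1 hρ, nonneg_of_mul_nonneg_right h2 hρ⟩

/-- A vertex of a triangle is extreme: it is a vertex of each smaller triangle containing it. -/
lemma Affine.Simplex.exists_vertex_eq {s t : Affine.Triangle ℝ Plane}
    (h : s.closedInterior ⊆ t.closedInterior) {n : Fin 3} (hn : t.points n ∈ s.closedInterior) :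
    ∃ m, s.points m = t.points n := by
  rw [mem_closedInterior_iff] at hn
  have hs := s.sum_bary (t.points n)
  have hvert : ∀ j k, 0 ≤ t.bary j (s.points k) := fun j k =>
    (t.mem_closedInterior_iff _).1 (h (Simplex.point_mem_closedInterior s k)) j
  -- The coordinate at `t.points n` is a convex combination of its nonnegative values at the
  -- vertices of `s`; if it is zero, so is every value of positive weight.
  have key : ∀ j, t.bary j (t.points n) = 0 → ∀ m, 0 < s.bary m (t.points n) →
      t.bary j (s.points m) = 0 := by
    intro j hj m hm
    have h1 := t.bary_affine j (s.points 0) (s.points 1) (s.points 2) hs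
    rw [s.sum_bary_smul, hj] at h1
    have p0 := mul_nonneg (hn 0) (hvert j 0)
    have p1 := mul_nonneg (hn 1) (hvert j 1)
    have p2 := mul_nonneg (hn 2) (hvert j 2)
    have : s.bary m (t.points n) * t.bary j (s.points m) = 0 := by
      fin_cases m <;> simp only [Fin.zero_eta, Fin.mk_one, Fin.reduceFinMk] <;> linarith
    exact (mul_eq_zero.1 this).resolve_left hm.ne'
  obtain ⟨m, hm⟩ : ∃ m, 0 < s.bary m (t.points n) := by
    by_contra! hc
    linarith [hc 0, hc 1, hc 2]
  refine ⟨m, t.eq_point_of_bary (key _ ?_ m hm) (key _ ?_ m hm)⟩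
  · have := t.bary_point_succ_succ (n + 1)
    rwa [Fin.three_add_one_add_two] at this
  · have := t.bary_point_succ (n + 2)
    rwa [Fin.three_add_two_add_one] at this

/-- The ray from the vertex `0` of an equilateral triangle in the direction that makes an angle `θ`
with the edge to the vertex `1`. -/
noncomputable def Affine.Simplex.ray (t : Affine.Triangle ℝ Plane) (θ : ℝ) : Plane :=
  Real.sin (π / 3 - θ) • (t.points 1 - t.points 0) + Real.sin θ • (t.points 2 - t.points 0)

/-- Both coefficients of `ray` are sines of shifted angles, so each satisfies the three-term sine
identity `key`. It gives the coordinates of a ray relative to two others, hence when it lies between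
them. -/
lemma Affine.Simplex.ray_combination (t : Affine.Triangle ℝ Plane) (θ₁ θ₂ θ : ℝ) :
    Real.sin (θ₂ - θ₁) • t.ray θ =
      Real.sin (θ₂ - θ) • t.ray θ₁ + Real.sin (θ - θ₁) • t.ray θ₂ := by
  have key : ∀ a b c : ℝ, Real.sin (b - a) * Real.sin c =
      Real.sin (b - c) * Real.sin a + Real.sin (c - a) * Real.sin b := by
    intro a b c
    simp only [Real.sin_sub]
    ring
  have h1 := key θ₁ θ₂ θ
  have h2 := key (π / 3 - θ₁) (π / 3 - θ₂) (π / 3 - θ)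
  rw [show π / 3 - θ₂ - (π / 3 - θ₁) = -(θ₂ - θ₁) by ring,
    show π / 3 - θ₂ - (π / 3 - θ) = -(θ₂ - θ) by ring,
    show π / 3 - θ - (π / 3 - θ₁) = -(θ - θ₁) by ring] at h2
  simp only [Real.sin_neg] at h2
  have h2' : Real.sin (θ₂ - θ₁) * Real.sin (π / 3 - θ) =
    Real.sin (θ₂ - θ) * Real.sin (π / 3 - θ₁) + Real.sin (θ - θ₁) * Real.sin (π / 3 - θ₂) := by
    linarith
  simp only [ray, smul_add, smul_smul]
  rw [h1, h2']
  module

lemma Affine.Simplex.inner_ray {t : Affine.Triangle ℝ Plane} (ht : t.Equilateral) (θ₁ θ₂ : ℝ) :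
    inner ℝ (t.ray θ₁) (t.ray θ₂) =
      3 / 4 * dist (t.points 0) (t.points 1) ^ 2 * Real.cos (θ₁ - θ₂) := by
  set X := dist (t.points 0) (t.points 1) with hX
  have h1 : ‖t.points 1 - t.points 0‖ = X := by rw [← dist_eq_norm, dist_comm]
  have h2 : ‖t.points 2 - t.points 0‖ = X := by
    rw [← dist_eq_norm]; exact ht.dist_eq (by decide) (by decide)
  have h3 : inner ℝ (t.points 1 - t.points 0) (t.points 2 - t.points 0) = X ^ 2 / 2 := by
    have h4 : ‖(t.points 1 - t.points 0) - (t.points 2 - t.points 0)‖ = X := by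
      rw [sub_sub_sub_cancel_right, ← dist_eq_norm]; exact ht.dist_eq (by decide) (by decide)
    have := norm_sub_sq_real (t.points 1 - t.points 0) (t.points 2 - t.points 0)
    rw [h4, h1, h2] at this
    linarith
  have h5 := real_inner_self_eq_norm_sq (t.points 1 - t.points 0)
  have h6 := real_inner_self_eq_norm_sq (t.points 2 - t.points 0)
  rw [h1] at h5
  rw [h2] at h6
  have h7 := real_inner_comm (t.points 1 - t.points 0) (t.points 2 - t.points 0)
  simp only [ray, inner_add_left, inner_add_right, inner_smul_left, inner_smul_right, h5, h6, h3,
    h7, conj_trivial, Real.sin_sub, Real.sin_pi_div_three, Real.cos_pi_div_three, Real.cos_sub]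
  have h8 : √3 ^ 2 = 3 := Real.sq_sqrt (by norm_num)
  ring_nf
  rw [h8]
  ring

lemma Affine.Simplex.angle_ray {t : Affine.Triangle ℝ Plane} (ht : t.Equilateral) {θ₁ θ₂ : ℝ}
    (h : θ₁ ≤ θ₂) (h' : θ₂ - θ₁ ≤ π) :
    InnerProductGeometry.angle (t.ray θ₁) (t.ray θ₂) = θ₂ - θ₁ := by
  have hX := t.dist_points_pos (show (0 : Fin 3) ≠ 1 by decide)
  have hn : ∀ θ, ‖t.ray θ‖ = √(3 / 4 * dist (t.points 0) (t.points 1) ^ 2) := by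
    intro θ
    rw [norm_eq_sqrt_real_inner, inner_ray ht]
    simp
  rw [InnerProductGeometry.angle, inner_ray ht, hn, hn, Real.mul_self_sqrt (by positivity),
    mul_div_cancel_left₀ _ (by positivity), ← Real.cos_neg, neg_sub]
  exact Real.arccos_cos (by linarith) h'

/-- Oblique coordinates with axes at angle $\frac{\pi}{3}$ correspond to $z=x+ye^{i\pi/3}$; $\theta$
is the argument of $z$, and the factor $2/\sqrt3$ in $r$ compensates for $\sin\frac{\pi}{3}$. -/
lemma exists_polar {x y : ℝ} (hx : 0 ≤ x) (hy : 0 ≤ y) (h : x ≠ 0 ∨ y ≠ 0) :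
    ∃ r θ : ℝ, 0 < r ∧ 0 ≤ θ ∧ θ ≤ π / 3 ∧ x = r * Real.sin (π / 3 - θ) ∧ y = r * Real.sin θ := by
  have h8 : √3 ^ 2 = 3 := Real.sq_sqrt (by norm_num)
  have h9 : 0 < √3 := by positivity
  have hpi := Real.pi_pos
  set z : ℂ := ⟨x + y / 2, √3 / 2 * y⟩ with hz
  have hz0 : z ≠ 0 := by
    intro h0
    have h1 : x + y / 2 = 0 := congrArg Complex.re h0
    rcases h with h | h
    · exact h (by linarith)
    · exact h (by linarith)
  have hr : 0 < ‖z‖ := norm_pos_iff.2 hz0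
  have hc : ‖z‖ * Real.cos z.arg = x + y / 2 := Complex.norm_mul_cos_arg z
  have hs : ‖z‖ * Real.sin z.arg = √3 / 2 * y := Complex.norm_mul_sin_arg z
  have ha0 : 0 ≤ z.arg := Complex.arg_nonneg_iff.2 (by simp [hz]; positivity)
  have hd : ‖z‖ * Real.sin (π / 3 - z.arg) = √3 / 2 * x := by
    rw [Real.sin_sub, Real.sin_pi_div_three, Real.cos_pi_div_three]
    linear_combination √3 / 2 * hc - 1 / 2 * hs
  refine ⟨2 / √3 * ‖z‖, z.arg, by positivity, ha0, ?_, ?_, ?_⟩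
  · by_contra! hlt
    have h1 : Real.sin (π / 3 - z.arg) < 0 :=
      Real.sin_neg_of_neg_of_neg_pi_lt (by linarith) (by linarith [Complex.arg_le_pi z])
    have : 0 ≤ √3 / 2 * x := by positivity
    nlinarith
  · rw [mul_assoc, hd]; field_simp
  · rw [mul_assoc, hs]; field_simp

/-- In polar coordinates at the vertex `0` of an equilateral triangle `t`, a smaller triangle with
this vertex is an interval whose length is the angle. -/
lemma Affine.Simplex.exists_angular_interval {s t : Affine.Triangle ℝ Plane} (ht : t.Equilateral)
    (h : s.closedInterior ⊆ t.closedInterior) {m : Fin 3} (hm : s.points m = t.points 0) :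
    ∃ lo hi : ℝ, 0 ≤ lo ∧ hi ≤ π / 3 ∧
      ∠ (s.points (m + 1)) (s.points m) (s.points (m + 2)) = hi - lo ∧
      (∀ θ ∈ Set.Ioo lo hi, ∀ᶠ ρ : ℝ in 𝓝[>] 0, t.points 0 + ρ • t.ray θ ∈ s.interior) ∧
      ∀ θ ∈ Set.Icc 0 (π / 3), ∀ ρ : ℝ, 0 < ρ → t.points 0 + ρ • t.ray θ ∈ s.closedInterior →
        θ ∈ Set.Icc lo hi := by
  have hpi := Real.pi_pos
  have polar : ∀ q ∈ t.closedInterior, q ≠ t.points 0 → ∃ r θ : ℝ, 0 < r ∧ 0 ≤ θ ∧ θ ≤ π / 3 ∧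
      q - t.points 0 = r • t.ray θ := by
    intro q hq hne
    have hq' := (t.mem_closedInterior_iff q).1 hq
    obtain ⟨r, θ, hr, h0, h1, hx, hy⟩ := exists_polar (hq' 1) (hq' 2) (by
      by_contra! hc
      exact hne (t.eq_point_of_bary hc.1 hc.2))
    refine ⟨r, θ, hr, h0, h1, ?_⟩
    have h2 := t.sum_bary_smul q
    have h3 : t.bary 0 q = 1 - t.bary 1 q - t.bary 2 q := by linarith [t.sum_bary q]
    rw [ray, smul_add, smul_smul, smul_smul, ← hx, ← hy]
    nth_rewrite 1 [← h2]
    rw [h3]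
    module
  have hinj := s.independent.injective
  -- The case in which the second side of `s` at the vertex has the larger polar angle; the opposite
  -- order follows by exchanging the sides, and equal angles would make `s` degenerate.
  have main : ∀ q₁ q₂ : Plane, IsLocalCone s.interior s.closedInterior (t.points 0) q₁ q₂ →
      ∀ r₁ r₂ θ₁ θ₂ : ℝ, 0 < r₁ → 0 < r₂ → 0 ≤ θ₁ → θ₂ ≤ π / 3 → θ₁ < θ₂ →
      q₁ - t.points 0 = r₁ • t.ray θ₁ → q₂ - t.points 0 = r₂ • t.ray θ₂ →
      ∃ lo hi : ℝ, 0 ≤ lo ∧ hi ≤ π / 3 ∧ ∠ q₁ (t.points 0) q₂ = hi - lo ∧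
      (∀ θ ∈ Set.Ioo lo hi, ∀ᶠ ρ : ℝ in 𝓝[>] 0, t.points 0 + ρ • t.ray θ ∈ s.interior) ∧
      ∀ θ ∈ Set.Icc 0 (π / 3), ∀ ρ : ℝ, 0 < ρ → t.points 0 + ρ • t.ray θ ∈ s.closedInterior →
        θ ∈ Set.Icc lo hi := by
    intro q₁ q₂ hcone r₁ r₂ θ₁ θ₂ hr₁ hr₂ h0 h1 hlt hq₁ hq₂
    have hsin : 0 < Real.sin (θ₂ - θ₁) := Real.sin_pos_of_pos_of_lt_pi (by linarith) (by linarith)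
    have hray : ∀ θ, t.ray θ = (Real.sin (θ₂ - θ) / (r₁ * Real.sin (θ₂ - θ₁))) • (q₁ - t.points 0) +
        (Real.sin (θ - θ₁) / (r₂ * Real.sin (θ₂ - θ₁))) • (q₂ - t.points 0) := by
      intro θ
      rw [hq₁, hq₂, smul_smul, smul_smul]
      have h2 := t.ray_combination θ₁ θ₂ θ
      have h3 : t.ray θ = (Real.sin (θ₂ - θ₁))⁻¹ • (Real.sin (θ₂ - θ₁) • t.ray θ) := by
        rw [smul_smul, inv_mul_cancel₀ hsin.ne', one_smul]
      rw [h3, h2, smul_add, smul_smul, smul_smul]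
      congr 2 <;> field_simp
    refine ⟨θ₁, θ₂, h0, h1, ?_, ?_, ?_⟩
    · rw [EuclideanGeometry.angle, vsub_eq_sub, vsub_eq_sub, hq₁, hq₂,
        InnerProductGeometry.angle_smul_left_of_pos _ _ hr₁,
        InnerProductGeometry.angle_smul_right_of_pos _ _ hr₂]
      exact angle_ray ht hlt.le (by linarith)
    · rintro θ ⟨h2, h3⟩
      rw [hray θ]
      refine (hcone _ _).1 (div_pos ?_ (by positivity)) (div_pos ?_ (by positivity))
      · exact Real.sin_pos_of_pos_of_lt_pi (by linarith) (by linarith)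
      · exact Real.sin_pos_of_pos_of_lt_pi (by linarith) (by linarith)
    · rintro θ ⟨h2, h3⟩ ρ hρ hmem
      rw [hray θ] at hmem
      obtain ⟨hx, hy⟩ := (hcone _ _).2.2 ρ hρ hmem
      constructor
      · by_contra! hc
        have h4 := Real.sin_neg_of_neg_of_neg_pi_lt (x := θ - θ₁) (by linarith) (by linarith)
        exact absurd hy (not_le.2 (div_neg_of_neg_of_pos h4 (by positivity)))
      · by_contra! hc
        have h4 := Real.sin_neg_of_neg_of_neg_pi_lt (x := θ₂ - θ) (by linarith) (by linarith)
        exact absurd hx (not_le.2 (div_neg_of_neg_of_pos h4 (by positivity)))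
  have hcone := s.isLocalCone m
  rw [hm] at hcone ⊢
  obtain ⟨r₁, θ₁, hr₁, h1, h1', hq₁⟩ := polar _ (h (Simplex.point_mem_closedInterior s (m + 1)))
    (by rw [← hm]; exact hinj.ne (by fin_cases m <;> decide))
  obtain ⟨r₂, θ₂, hr₂, h2, h2', hq₂⟩ := polar _ (h (Simplex.point_mem_closedInterior s (m + 2)))
    (by rw [← hm]; exact hinj.ne (by fin_cases m <;> decide))
  rcases lt_trichotomy θ₁ θ₂ with hlt | heq | hlt
  · exact main _ _ hcone r₁ r₂ θ₁ θ₂ hr₁ hr₂ h1 h2' hlt hq₁ hq₂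
  · exfalso
    have := s.signedArea_cyclic m
    rw [hm, hq₁, hq₂, heq, cross_smul_left, cross_smul_right, cross_same] at this
    exact s.signedArea_ne_zero (by rw [← this]; ring)
  · rw [EuclideanGeometry.angle_comm]
    exact main _ _ hcone.symm r₂ r₁ θ₂ θ₁ hr₂ hr₁ h2 h1' hlt hq₂ hq₁

namespace Tiling

variable {Δ T : Affine.Triangle ℝ Plane} {N : ℕ} (τ : Tiling Δ T N)

/-- Only one piece contains the vertex `0` of the tiled triangle. -/
theorem eq_of_mem_vertex (hΔ : Δ.Equilateral) {α β : ℝ} (hαβ : α + β = 2 * π / 3)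
    (hα : ∀ q : ℚ, α ≠ q * π)
    (hang : ∀ i k, ∠ ((τ.piece i).points (k + 1)) ((τ.piece i).points k)
        ((τ.piece i).points (k + 2)) = α ∨
      ∠ ((τ.piece i).points (k + 1)) ((τ.piece i).points k) ((τ.piece i).points (k + 2)) = β ∨
      ∠ ((τ.piece i).points (k + 1)) ((τ.piece i).points k) ((τ.piece i).points (k + 2)) = π / 3)
    {i j : Fin N} (hiA : Δ.points 0 ∈ (τ.piece i).closedInterior)
    (hj : Δ.points 0 ∈ (τ.piece j).closedInterior) : i = j := by
  classical
  have hpi := Real.pi_pos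
  set S : Finset (Fin N) :=
    Finset.univ.filter fun i => Δ.points 0 ∈ (τ.piece i).closedInterior with hS
  have hdata : ∀ i, ∃ lo hi : ℝ, i ∈ S → 0 ≤ hi - lo ∧ 0 ≤ lo ∧ hi ≤ π / 3 ∧
      (hi - lo = α ∨ hi - lo = β ∨ hi - lo = π / 3) ∧
      (∀ θ ∈ Set.Ioo lo hi, ∀ᶠ ρ : ℝ in 𝓝[>] 0,
        Δ.points 0 + ρ • Δ.ray θ ∈ (τ.piece i).interior) ∧
      ∀ θ ∈ Set.Icc 0 (π / 3), ∀ ρ : ℝ, 0 < ρ →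
        Δ.points 0 + ρ • Δ.ray θ ∈ (τ.piece i).closedInterior → θ ∈ Set.Icc lo hi := by
    intro i
    by_cases hi : i ∈ S
    · obtain ⟨m, hm⟩ := exists_vertex_eq (τ.piece_subset i) (Finset.mem_filter.1 hi).2
      obtain ⟨lo, hi, h1, h2, h3, h4, h5⟩ := exists_angular_interval hΔ (τ.piece_subset i) hm
      exact ⟨lo, hi, fun _ => ⟨h3 ▸ EuclideanGeometry.angle_nonneg _ _ _, h1, h2, h3 ▸ hang i m, h4, h5⟩⟩
    · exact ⟨0, 0, fun h => absurd h hi⟩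
  choose lo hi hlohi using hdata
  have hnn : ∀ i ∈ S, 0 ≤ hi i - lo i := fun i hi' => (hlohi i hi').1
  have hcover : Set.Icc 0 (π / 3) ⊆ ⋃ i ∈ S, Set.Icc (lo i) (hi i) := by
    intro θ hθ
    have h1 : ∀ᶠ ρ : ℝ in 𝓝[>] 0, Δ.points 0 + ρ • Δ.ray θ ∈ Δ.closedInterior :=
      ((Δ.isLocalCone 0) _ _).2.1
        (Real.sin_nonneg_of_nonneg_of_le_pi (by linarith [hθ.2]) (by linarith [hθ.1]))
        (Real.sin_nonneg_of_nonneg_of_le_pi hθ.1 (by linarith [hθ.2]))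
    have hc : ContinuousAt (fun ρ : ℝ => Δ.points 0 + ρ • Δ.ray θ) 0 := by fun_prop
    have h2 : ∀ᶠ ρ : ℝ in 𝓝[>] 0, ∀ j, j ∉ S →
        Δ.points 0 + ρ • Δ.ray θ ∉ (τ.piece j).closedInterior := by
      rw [eventually_all]
      intro j
      rw [eventually_imp_distrib_left]
      intro hj
      exact (hc.eventually ((Affine.Simplex.isClosed_closedInterior (τ.piece j)).isOpen_compl.mem_nhds
        (by simpa [hS] using hj))).filter_mono nhdsWithin_le_nhds
    obtain ⟨ρ, ⟨h3, h4⟩, h5⟩ := ((h1.and h2).and self_mem_nhdsWithin).exists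
    obtain ⟨i, hi⟩ := τ.exists_piece h3
    have hiS : i ∈ S := by
      by_contra h
      exact h4 i h hi
    exact Set.mem_iUnion₂.2 ⟨i, hiS, (hlohi i hiS).2.2.2.2.2 θ hθ ρ h5 hi⟩
  have hdisj : (S : Set (Fin N)).PairwiseDisjoint fun i => Set.Ioo (lo i) (hi i) := by
    intro i hi j hj hij
    refine Set.disjoint_left.2 fun θ h1 h2 => ?_
    obtain ⟨ρ, h3, h4⟩ :=
      (((hlohi i hi).2.2.2.2.1 θ h1).and ((hlohi j hj).2.2.2.2.1 θ h2)).exists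
    exact Set.disjoint_left.1 (τ.disjoint i j hij) h3 h4
  -- The angular intervals cover $[0,\frac{\pi}{3}]$ and their interiors are disjoint, so comparing
  -- lengths in both directions shows that the angles at $A$ sum to $\frac{\pi}{3}$.
  have hle : π / 3 ≤ ∑ i ∈ S, (hi i - lo i) := by
    have h1 : volume (Set.Icc 0 (π / 3)) ≤ ∑ i ∈ S, volume (Set.Icc (lo i) (hi i)) :=
      (measure_mono hcover).trans (measure_biUnion_finset_le _ _)
    simp only [Real.volume_Icc, sub_zero] at h1
    rw [← ENNReal.ofReal_sum_of_nonneg hnn] at h1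
    exact (ENNReal.ofReal_le_ofReal_iff (Finset.sum_nonneg hnn)).1 h1
  have hge : ∑ i ∈ S, (hi i - lo i) ≤ π / 3 := by
    have h1 : ∑ i ∈ S, volume (Set.Ioo (lo i) (hi i)) ≤ volume (Set.Icc 0 (π / 3)) := by
      rw [← measure_biUnion_finset hdisj fun i _ => measurableSet_Ioo]
      refine measure_mono (Set.iUnion₂_subset fun i hi x hx => ?_)
      exact ⟨(hlohi i hi).2.1.trans hx.1.le, hx.2.le.trans (hlohi i hi).2.2.1⟩
    simp only [Real.volume_Icc, Real.volume_Ioo, sub_zero] at h1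
    rw [← ENNReal.ofReal_sum_of_nonneg hnn] at h1
    exact (ENNReal.ofReal_le_ofReal_iff (by positivity)).1 h1
  -- Each of $\alpha$, $\beta=-\alpha+2\cdot\frac{\pi}{3}$ and $\frac{\pi}{3}$ has coefficient sum
  -- $1$, so the sum of all coefficients counts the pieces at $A$. By irrationality the total has
  -- coefficients $0$ and $1$.
  have hint : ∀ i, ∃ a b : ℤ, i ∈ S → hi i - lo i = a * α + b * (π / 3) ∧ a + b = 1 := by
    intro i
    by_cases hi : i ∈ S
    · rcases (hlohi i hi).2.2.2.1 with h | h | h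
      · exact ⟨1, 0, fun _ => ⟨by rw [h]; push_cast; ring, by norm_num⟩⟩
      · exact ⟨-1, 2, fun _ => ⟨by rw [h]; push_cast; linarith, by norm_num⟩⟩
      · exact ⟨0, 1, fun _ => ⟨by rw [h]; push_cast; ring, by norm_num⟩⟩
    · exact ⟨0, 0, fun h => absurd h hi⟩
  choose a b hab using hint
  have hsum : (∑ i ∈ S, a i : ℤ) * α + (∑ i ∈ S, b i : ℤ) * (π / 3) = π / 3 := by
    refine Eq.trans ?_ (le_antisymm hge hle)
    rw [Finset.sum_congr rfl fun i hi => (hab i hi).1, Finset.sum_add_distrib]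
    push_cast
    rw [Finset.sum_mul, Finset.sum_mul]
  have ha : ∑ i ∈ S, a i = 0 := by
    by_contra hne
    have hne' : ((∑ i ∈ S, a i : ℤ) : ℝ) ≠ 0 := by exact_mod_cast hne
    apply hα ((1 - (∑ i ∈ S, b i : ℤ)) / (3 * (∑ i ∈ S, a i : ℤ)))
    rw [Rat.cast_div, Rat.cast_mul, Rat.cast_sub, Rat.cast_intCast, Rat.cast_intCast, Rat.cast_one,
      Rat.cast_ofNat]
    field_simp
    linarith
  have hb : ∑ i ∈ S, b i = 1 := by
    rw [ha] at hsum
    have h1 : ((∑ i ∈ S, b i : ℤ) : ℝ) = 1 := by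
      have : (((∑ i ∈ S, b i : ℤ) : ℝ) - 1) * π = 0 := by
        simp only [Int.cast_zero, zero_mul, zero_add] at hsum
        linarith
      linarith [(mul_eq_zero.1 this).resolve_right hpi.ne']
    exact_mod_cast h1
  have hcard : S.card = 1 := by
    have h1 : ∑ i ∈ S, (a i + b i) = ∑ i ∈ S, (1 : ℤ) :=
      Finset.sum_congr rfl fun i hi => (hab i hi).2
    rw [Finset.sum_add_distrib, ha, hb, Finset.sum_const] at h1
    simp at h1
    exact_mod_cast h1.symm
  exact Finset.card_le_one.1 hcard.le i (by simpa [hS] using hiA) j (by simpa [hS] using hj)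

end Tiling

/-! ### Signed perimeters, measured by one-dimensional Hausdorff measure. -/

/-- The boundary of a triangle without the vertices. -/
def Affine.Simplex.edges (t : Affine.Triangle ℝ Plane) : Set Plane := {x | ∃ k, t.OnEdge k x}

lemma hausdorffMeasure_finite {s : Set Plane} (hs : s.Finite) : μH[1] s = 0 := by
  have := Measure.nullSingletonClass_hausdorff Plane (d := 1) one_pos
  exact hs.measure_zero _

lemma hausdorffMeasure_openSegment (p q : Plane) :
    μH[1] (openSegment ℝ p q) = edist p q := by
  rw [← hausdorffMeasure_segment p q, ← insert_endpoints_openSegment]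
  have h1 : μH[1] ({p, q} : Set Plane) = 0 := hausdorffMeasure_finite (Set.toFinite {p, q})
  have h2 : insert p (insert q (openSegment ℝ p q)) = {p, q} ∪ openSegment ℝ p q := by
    ext; simp [or_assoc]
  rw [h2]
  refine le_antisymm (measure_mono Set.subset_union_right) ((measure_union_le _ _).trans ?_)
  rw [h1, zero_add]

lemma Affine.Simplex.measurableSet_onEdge (t : Affine.Triangle ℝ Plane) (k : Fin 3) :
    MeasurableSet {x | t.OnEdge k x} := by
  have : {x | t.OnEdge k x} = t.bary k ⁻¹' {0} ∩
      (t.bary (k + 1) ⁻¹' Set.Ioi 0 ∩ t.bary (k + 2) ⁻¹' Set.Ioi 0) := by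
    ext x; rfl
  rw [this]
  exact ((t.continuous_bary k).measurable (measurableSet_singleton 0)).inter
    (((t.continuous_bary _).measurable measurableSet_Ioi).inter
      ((t.continuous_bary _).measurable measurableSet_Ioi))

lemma Affine.Simplex.edges_eq_iUnion (t : Affine.Triangle ℝ Plane) :
    t.edges = ⋃ k, {x | t.OnEdge k x} := by
  ext x; simp [edges]

lemma Affine.Simplex.measurableSet_edges (t : Affine.Triangle ℝ Plane) :
    MeasurableSet t.edges := by
  rw [edges_eq_iUnion]
  exact MeasurableSet.iUnion fun k => t.measurableSet_onEdge k

/-- The perimeter of a triangle. -/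
noncomputable def Affine.Simplex.perimeter (t : Affine.Triangle ℝ Plane) : ℝ :=
  dist (t.points 1) (t.points 2) + dist (t.points 0) (t.points 2) +
    dist (t.points 0) (t.points 1)

lemma Affine.Simplex.hausdorffMeasure_edges (t : Affine.Triangle ℝ Plane) :
    μH[1] t.edges = ENNReal.ofReal t.perimeter := by
  rw [edges_eq_iUnion, measure_iUnion (fun k l hkl => Set.disjoint_left.2 fun x h h' =>
    hkl (h.unique h')) t.measurableSet_onEdge, tsum_fintype, Fin.sum_univ_three]
  simp only [setOf_onEdge]
  rw [hausdorffMeasure_openSegment, hausdorffMeasure_openSegment, hausdorffMeasure_openSegment]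
  simp only [edist_dist, perimeter]
  rw [← ENNReal.ofReal_add dist_nonneg dist_nonneg, ← ENNReal.ofReal_add (by positivity) dist_nonneg]
  congr 2
  congr 1
  exact dist_comm _ _

namespace Tiling

variable {Δ T : Affine.Triangle ℝ Plane} {N : ℕ} (τ : Tiling Δ T N)

lemma dist_piece (i : Fin N) (k l : Fin 3) :
    dist ((τ.piece i).points k) ((τ.piece i).points l) = dist (T.points k) (T.points l) :=
  (τ.congruent i).dist_eq k l

lemma perimeter_piece (i : Fin N) : (τ.piece i).perimeter = T.perimeter := by
  simp only [perimeter, dist_piece]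

/-- An edge point inside `Δ` lies on the edges of exactly two pieces, of opposite colors; on an edge
of `Δ` it belongs to one piece, which is black. Integrating this pointwise identity yields the
perimeter relation. -/
lemma sum_indicator_edges {κ : Fin N → Bool} (hκ : ∀ i j, τ.Adjacent i j → κ i ≠ κ j)
    (hb : ∀ i k l, (τ.piece i).edgeDir k = Δ.edgeDir l → κ i = true) {x : Plane}
    (hx : x ∉ τ.vertices) (hxΔ : ∀ k, x ≠ Δ.points k) :
    ∑ i, (τ.piece i).edges.indicator (fun _ => if κ i = true then (1 : ℝ) else -1) x =
      Δ.edges.indicator (fun _ => 1) x := by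
  by_cases hxm : x ∈ Δ.closedInterior
  swap
  · rw [Set.indicator_of_notMem (s := Δ.edges) (fun ⟨k, hk⟩ => hxm hk.mem_closedInterior)]
    refine Finset.sum_eq_zero fun i _ => Set.indicator_of_notMem ?_ _
    rintro ⟨k, hk⟩
    exact hxm (τ.piece_subset i hk.mem_closedInterior)
  rcases Δ.mem_interior_or_onEdge hxm hxΔ with hin | ⟨l, hl⟩
  · rw [Set.indicator_of_notMem (s := Δ.edges) (fun ⟨k, hk⟩ => hk.notMem_interior hin)]
    by_cases he : ∃ i, x ∈ (τ.piece i).edges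
    swap
    · push Not at he
      exact Finset.sum_eq_zero fun i _ => Set.indicator_of_notMem (he i) _
    obtain ⟨i, k, hk⟩ := he
    obtain ⟨j, hji, l, hl⟩ := τ.exists_other hx hk hin
    rw [← Finset.sum_subset (Finset.subset_univ {i, j})]
    · rw [Finset.sum_pair hji.symm, Set.indicator_of_mem (s := (τ.piece i).edges) ⟨k, hk⟩,
        Set.indicator_of_mem (s := (τ.piece j).edges) ⟨l, hl⟩]
      have := hκ i j (τ.adjacent_of_onEdge hji.symm hk hl)
      cases h1 : κ i <;> cases h2 : κ j <;> simp_all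
    · intro m _ hm
      refine Set.indicator_of_notMem ?_ _
      -- Three edge directions cannot be pairwise opposite, so no third piece has an edge through
      -- `x`.
      rintro ⟨n, hn⟩
      simp only [Finset.mem_insert, Finset.mem_singleton, not_or] at hm
      have e1 := τ.edgeDir_eq_neg hji.symm hk hl
      have e2 := τ.edgeDir_eq_neg (Ne.symm hm.1) hk hn
      have e3 := τ.edgeDir_eq_neg (Ne.symm hm.2) hl hn
      rw [e1, e2] at e3
      have h0 := congrArg (fun v : Plane => v 0) e3
      have h1 := congrArg (fun v : Plane => v 1) e3
      simp only [PiLp.neg_apply] at h0 h1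
      have := (τ.piece i).edgeDir_sq k
      nlinarith
  · obtain ⟨i, k, hk, hd, huniq⟩ := τ.exists_onEdge_of_boundary hx hl
    rw [Set.indicator_of_mem (s := Δ.edges) ⟨l, hl⟩, Finset.sum_eq_single i]
    · rw [Set.indicator_of_mem (s := (τ.piece i).edges) ⟨k, hk⟩, if_pos (hb i k l hd)]
    · intro j _ hj
      refine Set.indicator_of_notMem ?_ _
      rintro ⟨n, hn⟩
      exact hj (huniq j hn.mem_closedInterior)
    · simp

/-- The edges in the interior cancel in the difference of the perimeters of the black and the white
pieces. -/
theorem sum_sign_mul_perimeter {κ : Fin N → Bool} (hκ : ∀ i j, τ.Adjacent i j → κ i ≠ κ j)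
    (hb : ∀ i k l, (τ.piece i).edgeDir k = Δ.edgeDir l → κ i = true) :
    (∑ i, if κ i = true then (1 : ℝ) else -1) * T.perimeter = Δ.perimeter := by
  have hfin : ∀ t : Affine.Triangle ℝ Plane, μH[1] t.edges ≠ ⊤ := fun t => by
    rw [hausdorffMeasure_edges]; exact ENNReal.ofReal_ne_top
  have hreal : ∀ t : Affine.Triangle ℝ Plane, (μH[1] : Measure Plane).real t.edges = t.perimeter :=
    fun t => by
      rw [Measure.real, hausdorffMeasure_edges, ENNReal.toReal_ofReal]
      unfold perimeter; positivity
  have hint : ∀ (t : Affine.Triangle ℝ Plane) (r : ℝ),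
      ∫ x, t.edges.indicator (fun _ => r) x ∂μH[1] = r * t.perimeter := by
    intro t r
    rw [integral_indicator t.measurableSet_edges, setIntegral_const, hreal, smul_eq_mul, mul_comm]
  have hae : ∀ᵐ x ∂(μH[1] : Measure Plane), ∑ i, (τ.piece i).edges.indicator
      (fun _ => if κ i = true then (1 : ℝ) else -1) x = Δ.edges.indicator (fun _ => 1) x := by
    have h1 : ∀ᵐ x ∂(μH[1] : Measure Plane), x ∉ τ.vertices :=
      measure_eq_zero_iff_ae_notMem.1 (hausdorffMeasure_finite τ.finite_vertices)
    have h2 : ∀ᵐ x ∂(μH[1] : Measure Plane), x ∉ Set.range Δ.points :=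
      measure_eq_zero_iff_ae_notMem.1 (hausdorffMeasure_finite (Set.finite_range _))
    filter_upwards [h1, h2] with x h3 h4
    exact τ.sum_indicator_edges hκ hb h3 fun k hk => h4 ⟨k, hk.symm⟩
  have h := integral_congr_ae hae
  rw [integral_finsetSum, hint, one_mul] at h
  · rw [← h, Finset.sum_mul]
    refine Finset.sum_congr rfl fun i _ => ?_
    rw [hint, perimeter_piece]
  · intro i _
    exact (integrable_indicator_iff (τ.piece i).measurableSet_edges).2
      (integrableOn_const (hfin _))

end Tiling

/-! ### Comparison of areas. -/

/-- Every triangle is an affine image of the standard one, with determinant `signedArea`. The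
constant is the area of the standard triangle; its value is irrelevant, as it cancels. -/
lemma Affine.Simplex.exists_volume_eq : ∃ c : ENNReal, ∀ t : Affine.Triangle ℝ Plane,
    volume t.closedInterior = ENNReal.ofReal |t.signedArea| * c := by
  refine ⟨volume {y : Plane | 0 ≤ y 0 ∧ 0 ≤ y 1 ∧ y 0 + y 1 ≤ 1}, fun t => ?_⟩
  set b := (EuclideanSpace.basisFun (Fin 2) ℝ).toBasis
  set u := t.points 1 - t.points 0 with hu
  set v := t.points 2 - t.points 0 with hv
  set L : Plane →ₗ[ℝ] Plane := Matrix.toLin b b !![u 0, v 0; u 1, v 1] with hL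
  have hdet : LinearMap.det L = t.signedArea := by
    rw [hL, LinearMap.det_toLin, Matrix.det_fin_two_of, signedArea, cross]
    ring
  have hLy : ∀ y, L y = y 0 • u + y 1 • v := by
    intro y
    rw [hL, Matrix.toLin_apply]
    apply Plane.ext <;> simp [b, Matrix.mulVec, dotProduct, Fin.sum_univ_two] <;> ring
  have himg : t.closedInterior = (fun y => t.points 0 + y) ''
      (L '' {y : Plane | 0 ≤ y 0 ∧ 0 ≤ y 1 ∧ y 0 + y 1 ≤ 1}) := by
    ext x
    rw [mem_closedInterior_iff]
    constructor
    · intro h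
      have hs := t.sum_bary x
      refine ⟨_, ⟨!₂[t.bary 1 x, t.bary 2 x], ⟨h 1, h 2, ?_⟩, rfl⟩, ?_⟩
      · have := h 0
        simp
        linarith
      · change _ + L _ = x
        have h0 : t.bary 0 x = 1 - t.bary 1 x - t.bary 2 x := by linarith
        nth_rewrite 3 [← t.sum_bary_smul x]
        rw [hLy, h0, hu, hv]
        simp
        module
    · rintro ⟨_, ⟨y, ⟨h0, h1, h2⟩, rfl⟩, rfl⟩
      change ∀ k, 0 ≤ t.bary k (_ + L y)
      rw [hLy]
      obtain ⟨e0, e1, e2⟩ := t.bary_vertex_add 0 (y 0) (y 1)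
      intro k
      fin_cases k
      · exact (by linarith : 0 ≤ 1 - y 0 - y 1).trans_eq e0.symm
      · exact h0.trans_eq e1.symm
      · exact h1.trans_eq e2.symm
  rw [himg, Set.image_add_left, measure_preimage_add, Measure.addHaar_image_linearMap, hdet]

/-- Heron's formula, from $(u\times v)^2=|u|^2|v|^2-(u\cdot v)^2$. It shows that congruent
triangles, reflected or not, have the same `|signedArea|`. -/
lemma Affine.Simplex.four_mul_signedArea_sq (t : Affine.Triangle ℝ Plane) :
    4 * t.signedArea ^ 2 =
      4 * dist (t.points 0) (t.points 1) ^ 2 * dist (t.points 0) (t.points 2) ^ 2 -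
      (dist (t.points 0) (t.points 1) ^ 2 + dist (t.points 0) (t.points 2) ^ 2 -
        dist (t.points 1) (t.points 2) ^ 2) ^ 2 := by
  simp only [dist_eq_norm, Plane.norm_sq, signedArea, cross, PiLp.sub_apply]
  ring

namespace Tiling

variable {Δ T : Affine.Triangle ℝ Plane} {N : ℕ} (τ : Tiling Δ T N)

lemma volume_inter {i j : Fin N} (hij : i ≠ j) :
    volume ((τ.piece i).closedInterior ∩ (τ.piece j).closedInterior) = 0 := by
  refine measure_mono_null (t := τ.vertices ∪ ⋃ k : Fin 3, ((affineSpan ℝ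
    {(τ.piece i).points (k + 1), (τ.piece i).points (k + 2)} : AffineSubspace ℝ Plane) :
      Set Plane)) ?_ ?_
  · rintro x ⟨hi, hj⟩
    by_cases hx : x ∈ τ.vertices
    · exact Or.inl hx
    · right
      obtain ⟨k, hk⟩ := τ.exists_onEdge_of_mem_of_mem hij hx hi hj
      refine Set.mem_iUnion.2 ⟨k, ?_⟩
      have hk' : x ∈ {x | (τ.piece i).OnEdge k x} := hk
      rw [setOf_onEdge, openSegment_eq_image_lineMap] at hk'
      obtain ⟨r, -, rfl⟩ := hk'
      exact AffineMap.lineMap_mem_affineSpan_pair _ _ _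
  · exact measure_union_null (τ.finite_vertices.measure_zero _)
      (measure_iUnion_null fun k => volume_line_eq_zero)

/-- The areas of the pieces add up. -/
theorem card_mul_abs_signedArea (τ : Tiling Δ T N) : N * |T.signedArea| = |Δ.signedArea| := by
  obtain ⟨c, hc⟩ := exists_volume_eq
  have hpiece : ∀ i, |(τ.piece i).signedArea| = |T.signedArea| := by
    intro i
    have h1 := (τ.piece i).four_mul_signedArea_sq
    have h2 := T.four_mul_signedArea_sq
    simp only [dist_piece] at h1
    rw [← sq_eq_sq_iff_abs_eq_abs]
    linarith
  have hsum : volume Δ.closedInterior = ∑ i, volume (τ.piece i).closedInterior := by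
    rw [← τ.cover, measure_iUnion₀ (fun i j hij => τ.volume_inter hij)
      (fun i => (Affine.Simplex.isClosed_closedInterior (τ.piece i)).measurableSet.nullMeasurableSet),
      tsum_fintype]
  simp only [hc, hpiece, Finset.sum_const, Finset.card_univ, Fintype.card_fin, nsmul_eq_mul] at hsum
  have hpos : volume Δ.closedInterior ≠ 0 := fun h =>
    (Δ.isOpen_interior.measure_pos volume Δ.interior_nonempty).ne'
      (measure_mono_null Δ.interior_subset h)
  have hfin : volume Δ.closedInterior ≠ ⊤ :=
    (Affine.Simplex.isCompact_closedInterior Δ).measure_lt_top.ne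
  rw [hc] at hpos hfin
  have hA := abs_pos.2 Δ.signedArea_ne_zero
  have hc0 : c ≠ 0 := right_ne_zero_of_mul hpos
  have hct : c ≠ ⊤ := by
    rintro rfl
    exact hfin (ENNReal.mul_top (by simpa using Δ.signedArea_ne_zero))
  rw [← mul_assoc, ENNReal.mul_left_inj hc0 hct, ← ENNReal.ofReal_natCast,
    ← ENNReal.ofReal_mul (Nat.cast_nonneg N),
    ENNReal.ofReal_eq_ofReal_iff (abs_nonneg _) (by positivity)] at hsum
  exact hsum.symm

/-! ### A black tile at $A$, and uniqueness of the coloring. -/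

/-- Some piece containing the vertex `0` has an edge on the boundary of the tiled triangle. -/
lemma exists_edgeDir_eq_at_vertex : ∃ i k l, Δ.points 0 ∈ (τ.piece i).closedInterior ∧
    (τ.piece i).edgeDir k = Δ.edgeDir l := by
  have hne := Δ.independent.injective.ne (show (1 : Fin 3) ≠ 0 by decide)
  have hc : ContinuousAt (fun ρ : ℝ => Δ.points 0 + ρ • (Δ.points 1 - Δ.points 0)) 0 := by fun_prop
  have h1 : ∀ᶠ ρ : ℝ in 𝓝[>] 0, ∀ j, Δ.points 0 ∉ (τ.piece j).closedInterior →
      Δ.points 0 + ρ • (Δ.points 1 - Δ.points 0) ∉ (τ.piece j).closedInterior := by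
    rw [eventually_all]
    intro j
    rw [eventually_imp_distrib_left]
    intro hj
    exact (hc.eventually ((Affine.Simplex.isClosed_closedInterior (τ.piece j)).isOpen_compl.mem_nhds
      (by simpa using hj))).filter_mono nhdsWithin_le_nhds
  have h2 : ∀ᶠ ρ : ℝ in 𝓝[>] 0, Δ.points 0 + ρ • (Δ.points 1 - Δ.points 0) ∉
      τ.vertices \ {Δ.points 0} :=
    (hc.eventually ((τ.finite_vertices.subset Set.sdiff_subset).isClosed.isOpen_compl.mem_nhds
      (by simp))).filter_mono nhdsWithin_le_nhds
  have h3 : ∀ᶠ ρ : ℝ in 𝓝[>] 0, ρ < 1 := nhdsWithin_le_nhds (gt_mem_nhds one_pos)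
  -- A point of the side from vertex `0` to vertex `1`, so close to vertex `0` that it is not a
  -- vertex of any piece and every piece containing it also contains vertex `0`.
  obtain ⟨ρ, ⟨⟨h1, h2⟩, h3⟩, h4⟩ := (((h1.and h2).and h3).and self_mem_nhdsWithin).exists
  have h4 : 0 < ρ := h4
  set x := Δ.points 0 + ρ • (Δ.points 1 - Δ.points 0) with hx
  have hxv : x ∉ τ.vertices := fun h => h2 ⟨h, fun h0 => by
    have h5 : ρ • (Δ.points 1 - Δ.points 0) = 0 := by simpa [hx] using h0
    exact hne (sub_eq_zero.1 ((smul_eq_zero.1 h5).resolve_left h4.ne'))⟩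
  have hxe : Δ.OnEdge 2 x := by
    obtain ⟨e0, e1, e2⟩ := Δ.bary_vertex_add 0 ρ 0
    have hx' : Δ.points 0 + (ρ • (Δ.points (0 + 1) - Δ.points 0) +
        (0 : ℝ) • (Δ.points (0 + 2) - Δ.points 0)) = x := by simp [hx]
    rw [hx'] at e0 e1 e2
    exact ⟨e2, (by linarith : (0 : ℝ) < 1 - ρ - 0).trans_eq e0.symm, h4.trans_eq e1.symm⟩
  obtain ⟨i, k, hk, hd, -⟩ := τ.exists_onEdge_of_boundary hxv hxe
  refine ⟨i, k, 2, ?_, hd⟩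
  by_contra h
  exact h1 i h hk.mem_closedInterior

lemma IsColoring.eq {τ : Tiling Δ T N} {κ κ' : Fin N → Bool} (h : τ.IsColoring κ)
    (h' : τ.IsColoring κ') : κ = κ' := by
  obtain ⟨i, hi⟩ := τ.exists_piece (Affine.Simplex.point_mem_closedInterior Δ 0)
  funext j
  induction τ.connected i j with
  | refl => rw [h.1 i hi, h'.1 i hi]
  | tail _ hadj ih =>
    have h1 := h.2 _ _ hadj
    have h2 := h'.2 _ _ hadj
    rw [← ih] at h2
    exact Bool.eq_not_of_ne h1.symm |>.trans (Bool.eq_not_of_ne h2.symm).symm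

/-- The sum of the signs of the pieces is the number of black minus the number of white ones. -/
lemma sum_sign (κ : Fin N → Bool) :
    (∑ i, if κ i = true then (1 : ℝ) else -1) =
      ((((Finset.univ.filter fun i => κ i = true).card : ℤ) -
        ((Finset.univ.filter fun i => κ i = false).card : ℤ) : ℤ) : ℝ) := by
  rw [Finset.sum_ite]
  simp [sub_eq_add_neg]

end Tiling

/-! ### Algebraic consequences of the perimeter and area relations; $K$ stands for $M^2$. -/

section Algebra

variable {N K a b c X : ℝ}

/-- Square the perimeter relation and insert $9X^2=9Nab=3N((a+b)^2-c^2)$; the factor $a+b+c$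
cancels. -/
lemma linear_relation (ha : 0 < a) (hb : 0 < b) (hc : 0 < c) (hcos : c ^ 2 = a ^ 2 + b ^ 2 - a * b)
    {M : ℝ} (hper : M * (a + b + c) = 3 * X) (harea : N * (a * b) = X ^ 2) :
    M ^ 2 * (a + b + c) = 3 * N * (a + b - c) := by
  have h : (a + b + c) * (M ^ 2 * (a + b + c) - 3 * N * (a + b - c)) = 0 := by
    have h1 : (M * (a + b + c)) ^ 2 = (3 * X) ^ 2 := by rw [hper]
    linear_combination h1 - 9 * harea + 3 * N * hcos
  have := (mul_eq_zero.1 h).resolve_left (by positivity)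
  linarith

lemma lt_three_mul (ha : 0 < a) (hb : 0 < b) (hc : 0 < c) (hN : 0 < N) (hK : 0 ≤ K)
    (hlin : K * (a + b + c) = 3 * N * (a + b - c)) : K < 3 * N := by
  by_contra! h
  have : 0 < 3 * N * c := by positivity
  have : 3 * N * (a + b) ≤ K * (a + b) := mul_le_mul_of_nonneg_right h (by positivity)
  nlinarith [mul_nonneg hK hc.le]

/-- Use $3(a-b)^2=4c^2-(a+b)^2$ with $(3N-K)(a+b)=(3N+K)c$; then $4(3N-K)^2-(3N+K)^2$ factors as
$3(9N-K)(N-K)$. -/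
lemma sub_sq_relation (hcos : c ^ 2 = a ^ 2 + b ^ 2 - a * b)
    (hlin : K * (a + b + c) = 3 * N * (a + b - c)) :
    (3 * N - K) ^ 2 * (a - b) ^ 2 = (9 * N - K) * (N - K) * c ^ 2 := by
  have h1 : (3 * N - K) * (a + b) = (3 * N + K) * c := by linarith
  have h2 : ((3 * N - K) * (a + b)) ^ 2 = ((3 * N + K) * c) ^ 2 := by rw [h1]
  linear_combination -1 / 3 * h2 - 4 / 3 * (3 * N - K) ^ 2 * hcos

lemma lt_of_relation (ha : 0 < a) (hb : 0 < b) (hc : 0 < c) (hN : 0 < N) (hK : 0 ≤ K)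
    (hab : a ≠ b) (hcos : c ^ 2 = a ^ 2 + b ^ 2 - a * b)
    (hlin : K * (a + b + c) = 3 * N * (a + b - c)) : K < N := by
  have h3 := lt_three_mul ha hb hc hN hK hlin
  have h := sub_sq_relation hcos hlin
  have hpos : 0 < (3 * N - K) ^ 2 * (a - b) ^ 2 :=
    mul_pos (pow_pos (by linarith) 2) (sq_pos_of_ne_zero (sub_ne_zero.2 hab))
  rw [h] at hpos
  by_contra! hle
  have : (9 * N - K) * (N - K) ≤ 0 :=
    mul_nonpos_of_nonneg_of_nonpos (by linarith) (by linarith)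
  nlinarith [sq_nonneg c]

lemma ratio_relation (hba : b ≤ a) (hc : 0 < c) (hK : K < 3 * N)
    (hcos : c ^ 2 = a ^ 2 + b ^ 2 - a * b)
    (hlin : K * (a + b + c) = 3 * N * (a + b - c)) :
    a / c = 1 / 2 * ((3 * N + K) / (3 * N - K) + √((9 * N - K) * (N - K)) / (3 * N - K)) ∧
    b / c = 1 / 2 * ((3 * N + K) / (3 * N - K) - √((9 * N - K) * (N - K)) / (3 * N - K)) := by
  have h := sub_sq_relation hcos hlin
  have hd : 0 < 3 * N - K := by linarith
  have hsqrt : √((9 * N - K) * (N - K)) = (3 * N - K) * (a - b) / c := by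
    have h1 : 0 ≤ (3 * N - K) * (a - b) / c :=
      div_nonneg (mul_nonneg hd.le (sub_nonneg.2 hba)) hc.le
    rw [← Real.sqrt_sq h1, div_pow, mul_pow, h, mul_div_cancel_right₀ _ (by positivity)]
  rw [hsqrt]
  constructor <;>
  · field_simp
    linarith

/-- Since $\sqrt3\sin\alpha+\cos\alpha=\zeta e^{-i\pi/3}+\zeta^{-1}e^{i\pi/3}$, dividing the
hypothesis by $\frac{\sqrt3}{2}$ and multiplying by $(1-i\sqrt3)\zeta=2e^{-i\pi/3}\zeta$ gives the
quadratic. -/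
lemma quadratic_relation {N M : ℝ} {α : ℝ}
    (h : M ^ 2 * (3 / 2 * Real.sin α + √3 / 2 * Real.cos α + √3 / 2) =
      3 * N * (3 / 2 * Real.sin α + √3 / 2 * Real.cos α - √3 / 2)) :
    ((M : ℂ) ^ 2 * (-iSqrtThree - 1) + (N : ℂ) * (3 * iSqrtThree + 3)) *
        Complex.exp (Complex.I * (α : ℂ)) ^ 2 +
      ((M : ℂ) ^ 2 * (-iSqrtThree + 1) + (N : ℂ) * (-3 * iSqrtThree + 3)) *
        Complex.exp (Complex.I * (α : ℂ)) + (2 * (M : ℂ) ^ 2 - 6 * (N : ℂ)) = 0 := by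
  have h3 : √3 * √3 = 3 := Real.mul_self_sqrt (by norm_num)
  have h' : M ^ 2 * (√3 * Real.sin α + Real.cos α + 1) =
      3 * N * (√3 * Real.sin α + Real.cos α - 1) := by
    have h4 : (√3 / 2) ≠ 0 := by positivity
    apply mul_left_cancel₀ h4
    linear_combination h + (M ^ 2 / 2 * Real.sin α - 3 / 2 * N * Real.sin α) * h3
  have hsc := Real.sin_sq_add_cos_sq α
  rw [mul_comm Complex.I, Complex.exp_mul_I, ← Complex.ofReal_cos, ← Complex.ofReal_sin, iSqrtThree]
  have h3c : ((√3 : ℝ) : ℂ) * (√3 : ℝ) = 3 := by exact_mod_cast h3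
  have hc : (M : ℂ) ^ 2 * ((√3 : ℝ) * (Real.sin α : ℝ) + (Real.cos α : ℝ) + 1) =
      3 * N * ((√3 : ℝ) * (Real.sin α : ℝ) + (Real.cos α : ℝ) - 1) := by exact_mod_cast h'
  have hscc : ((Real.sin α : ℝ) : ℂ) ^ 2 + ((Real.cos α : ℝ) : ℂ) ^ 2 = 1 := by exact_mod_cast hsc
  have hI := Complex.I_mul_I
  generalize ((√3 : ℝ) : ℂ) = r at *
  generalize ((Real.sin α : ℝ) : ℂ) = s at *
  generalize ((Real.cos α : ℝ) : ℂ) = t at *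
  generalize (M : ℂ) = m at *
  generalize (N : ℂ) = n at *
  have hI' : Complex.I ^ 2 = -1 := by rw [sq, hI]
  have hr : r ^ 2 = 3 := by rw [sq, h3c]
  generalize Complex.I = i at *
  linear_combination (1 - i * r) * (t + s * i) * hc +
    (m ^ 2 - 3 * n) * ((t + s * i) * (i * s * hr - r * s * hI') - 2 * hscc + 2 * s ^ 2 * hI')

end Algebra

/-! ### Assembly of the main theorem. -/

theorem mainTheorem3 (N : ℕ) (Δ T : Affine.Triangle ℝ Plane) (hΔ : Δ.Equilateral)
    (τ : Tiling Δ T N) (α β a b c : ℝ)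
    (hα : ∠ (T.points 1) (T.points 0) (T.points 2) = α)
    (hβ : ∠ (T.points 0) (T.points 1) (T.points 2) = β)
    (hγ : ∠ (T.points 0) (T.points 2) (T.points 1) = π / 3)
    (ha : dist (T.points 1) (T.points 2) = a)
    (hb : dist (T.points 0) (T.points 2) = b)
    (hc : dist (T.points 0) (T.points 1) = c)
    (hirr : ∀ q : ℚ, β ≠ (q : ℝ) * π) :
    (∃! M : ℤ, τ.IsColoringNumber M) ∧
    ∀ M : ℤ, τ.IsColoringNumber M →
      -- the explicit quadratic equation over ℚ(i√3) for ζ = exp(iα)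
      (quadCoeff N M ∈ ℚ⟮iSqrtThree⟯ ∧ linCoeff N M ∈ ℚ⟮iSqrtThree⟯ ∧
        constCoeff N M ∈ ℚ⟮iSqrtThree⟯ ∧ quadCoeff N M ≠ 0 ∧
        quadCoeff N M * Complex.exp (Complex.I * (α : ℂ)) ^ 2 +
          linCoeff N M * Complex.exp (Complex.I * (α : ℂ)) + constCoeff N M = 0) ∧
      -- the shape of the tile
      ((a / c = ratioPlus N M ∧ b / c = ratioMinus N M) ∨
        (a / c = ratioMinus N M ∧ b / c = ratioPlus N M)) ∧
      M ^ 2 < (N : ℤ) := by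
  have ha0 : 0 < a := ha ▸ T.dist_points_pos (by decide)
  have hb0 : 0 < b := hb ▸ T.dist_points_pos (by decide)
  have hc0 : 0 < c := hc ▸ T.dist_points_pos (by decide)
  have hαβ : α + β = 2 * π / 3 := by
    have h := angle_add_angle_add_angle_eq_pi (T.points 2)
      (T.independent.injective.ne (show (1 : Fin 3) ≠ 0 by decide))
    rw [hβ, angle_comm (T.points 1), hγ, angle_comm (T.points 2), hα] at h
    linarith
  have hirrα : ∀ q : ℚ, α ≠ q * π := by
    intro q hq
    apply hirr (2 / 3 - q)
    push_cast
    linarith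
  have hcos : c ^ 2 = a ^ 2 + b ^ 2 - a * b := by
    have h := law_cos (T.points 0) (T.points 2) (T.points 1)
    rw [hγ, Real.cos_pi_div_three, hc, hb, ha] at h
    linarith
  have hsinβ : Real.sin β = √3 / 2 * (b / c) := by
    have h := law_sin (T.points 1) (T.points 2) (T.points 0)
    rw [angle_comm, hγ, dist_comm, hb, hβ, hc, Real.sin_pi_div_three] at h
    field_simp
    linarith
  have hsinα : Real.sin α = √3 / 2 * (a / c) := by
    have h := law_sin (T.points 0) (T.points 2) (T.points 1)
    rw [hγ, hα, dist_comm, ha, dist_comm, hc, Real.sin_pi_div_three] at h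
    field_simp
    linarith
  -- If $a=b$, the tile is equilateral and $\beta=\frac{\pi}{3}$ is a rational multiple of $\pi$.
  have hab : a ≠ b := by
    intro h
    have hca : c = a := by
      rw [← h] at hcos
      have : c ^ 2 = a ^ 2 := by rw [hcos]; ring
      exact (pow_left_inj₀ hc0.le ha0.le two_ne_zero).1 this
    have hT : T.Equilateral := by
      rw [Affine.Triangle.equilateral_iff_dist_01_eq_02_and_dist_01_eq_12, hc, hb, ha]
      exact ⟨hca.trans h, hca⟩
    have h1 := hT.angle_eq_pi_div_three (i₁ := 0) (i₂ := 1) (i₃ := 2) (by decide) (by decide)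
      (by decide)
    apply hirr (1 / 3)
    rw [← hβ, h1]
    push_cast
    ring
  have hangle : ∀ i j k l, ∠ ((τ.piece i).points j) ((τ.piece i).points k)
      ((τ.piece i).points l) = ∠ (T.points j) (T.points k) (T.points l) := fun i j k l =>
    angle_eq_of_congruent (τ.congruent i) j k l
  obtain ⟨κ, hκ, hκb⟩ := τ.exists_coloring hΔ hαβ hirrα (fun i k => by
    rw [hangle]
    fin_cases k
    · exact Or.inr (Or.inr ((angle_comm _ _ _).trans hγ))
    · exact Or.inl ((angle_comm _ _ _).trans hα)
    · exact Or.inr (Or.inl hβ))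
  have hcol : τ.IsColoring κ := by
    refine ⟨fun i hi => ?_, hκ⟩
    obtain ⟨j, k, l, hj, hd⟩ := τ.exists_edgeDir_eq_at_vertex
    have hij : i = j := τ.eq_of_mem_vertex hΔ hαβ hirrα (fun i k => by
      rw [hangle]
      fin_cases k
      · exact Or.inl hα
      · exact Or.inr (Or.inl ((angle_comm _ _ _).trans hβ))
      · exact Or.inr (Or.inr hγ)) hi hj
    exact hij ▸ hκb j k l hd
  refine ⟨⟨_, ⟨κ, hcol, rfl⟩, ?_⟩, ?_⟩
  · rintro M ⟨κ', hcol', rfl⟩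
    rw [hcol'.eq hcol]
  rintro M ⟨κ', hcol', hM⟩
  rw [hcol'.eq hcol] at hM
  set X := dist (Δ.points 0) (Δ.points 1) with hX
  have hX1 : dist (Δ.points 0) (Δ.points 2) = X := hΔ.dist_eq (by decide) (by decide)
  have hX2 : dist (Δ.points 1) (Δ.points 2) = X := hΔ.dist_eq (by decide) (by decide)
  have hX0 : 0 < X := Δ.dist_points_pos (by decide)
  have hper : (M : ℝ) * (a + b + c) = 3 * X := by
    have h := τ.sum_sign_mul_perimeter hκ hκb
    rw [Tiling.sum_sign, ← hM, perimeter, perimeter, ha, hb, hc, ← hX, hX1, hX2] at h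
    linarith
  have harea : (N : ℝ) * (a * b) = X ^ 2 := by
    have h := τ.card_mul_abs_signedArea
    have h1 := T.four_mul_signedArea_sq
    have h2 := Δ.four_mul_signedArea_sq
    rw [ha, hb, hc] at h1
    rw [← hX, hX1, hX2] at h2
    have h3 : (N : ℝ) ^ 2 * T.signedArea ^ 2 = Δ.signedArea ^ 2 := by
      rw [← sq_abs T.signedArea, ← sq_abs Δ.signedArea, ← h]; ring
    have h4 : ((N : ℝ) * (a * b)) ^ 2 = (X ^ 2) ^ 2 := by
      -- The tile and `Δ` both have an angle $\frac{\pi}{3}$, so the ratio of their areas is that of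
      -- $ab$ to $X^2$.
      have h5 : 4 * T.signedArea ^ 2 = 3 * (a * b) ^ 2 := by
        rw [h1, hcos]; ring
      linear_combination 4 / 3 * h3 + 1 / 3 * h2 - 1 / 3 * N ^ 2 * h5
    exact (pow_left_inj₀ (by positivity) (by positivity) two_ne_zero).1 h4
  have hN : (0 : ℝ) < N := by
    by_contra! h
    have : (N : ℝ) * (a * b) ≤ 0 := mul_nonpos_of_nonpos_of_nonneg h (by positivity)
    nlinarith
  have hlin := linear_relation ha0 hb0 hc0 hcos hper harea
  have hK3 := lt_three_mul ha0 hb0 hc0 hN (sq_nonneg (M : ℝ)) hlin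
  have hKN := lt_of_relation ha0 hb0 hc0 hN (sq_nonneg (M : ℝ)) hab hcos hlin
  have hmem : iSqrtThree ∈ ℚ⟮iSqrtThree⟯ := IntermediateField.mem_adjoin_simple_self ℚ _
  have hnat : ∀ n : ℕ, (n : ℂ) ∈ ℚ⟮iSqrtThree⟯ := fun n => natCast_mem _ n
  have hofNat : ∀ n : ℕ, [n.AtLeastTwo] → (OfNat.ofNat n : ℂ) ∈ ℚ⟮iSqrtThree⟯ :=
    fun n _ => ofNat_mem _ n
  have hMmem : (M : ℂ) ^ 2 ∈ ℚ⟮iSqrtThree⟯ := pow_mem (intCast_mem _ M) 2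
  refine ⟨⟨?_, ?_, ?_, ?_, ?_⟩, ?_, ?_⟩
  · exact add_mem (mul_mem hMmem (sub_mem (neg_mem hmem) (one_mem _)))
      (mul_mem (hnat N) (add_mem (mul_mem (hofNat 3) hmem) (hofNat 3)))
  · exact add_mem (mul_mem hMmem (add_mem (neg_mem hmem) (one_mem _)))
      (mul_mem (hnat N) (add_mem (mul_mem (neg_mem (hofNat 3)) hmem) (hofNat 3)))
  · exact sub_mem (mul_mem (hofNat 2) hMmem) (mul_mem (hofNat 6) (hnat N))
  · intro h
    have h1 := congrArg Complex.re h
    -- The leading coefficient factors as $(1+i\sqrt3)(3N-M^2)$, and $M^2<3N$.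
    have h2 : (quadCoeff N M) = (iSqrtThree + 1) * ((3 * N - M ^ 2 : ℝ) : ℂ) := by
      rw [quadCoeff]; push_cast; ring
    rw [h2] at h1
    simp [iSqrtThree, -Complex.ofReal_sub] at h1
    linarith
  · have h : (M : ℝ) ^ 2 * (3 / 2 * Real.sin α + √3 / 2 * Real.cos α + √3 / 2) =
        3 * N * (3 / 2 * Real.sin α + √3 / 2 * Real.cos α - √3 / 2) := by
      have hβ' : Real.sin β = √3 / 2 * Real.cos α + 1 / 2 * Real.sin α := by
        rw [show β = π - (α + π / 3) by linarith, Real.sin_pi_sub, Real.sin_add,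
          Real.cos_pi_div_three, Real.sin_pi_div_three]
        ring
      -- The left side is $\sin\alpha+\sin\beta$, so by the law of sines the goal is the linear
      -- relation divided by $c$.
      have h1 : 3 / 2 * Real.sin α + √3 / 2 * Real.cos α = √3 / 2 * ((a + b) / c) := by
        have : 3 / 2 * Real.sin α + √3 / 2 * Real.cos α = Real.sin α + Real.sin β := by
          rw [hβ']; ring
        rw [this, hsinα, hsinβ]; ring
      rw [h1]
      field_simp
      linear_combination hlin
    have := quadratic_relation h
    simpa [quadCoeff, linCoeff, constCoeff] using this
  · rcases le_total b a with hle | hle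
    · exact Or.inl (ratio_relation hle hc0 hK3 hcos hlin)
    · exact Or.inr (ratio_relation hle hc0 hK3 (by linarith) (by linarith)).symm
  · exact_mod_cast hKN
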